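/- Let $X=H^1_0(0,1)$ be the complex Sobolev space (the closure of $C_c^\infty(0,1)$ in $H^1(0,1)$) with norm $\|z\|_{X}=\|z'\|_{L^2(0,1)}$. Consider the controlled Schrödinger equation $$\dot z(t,x)=i\,z_{xx}(t,x)-z(t,x)+z(t,x)^2+u_1(t,x),\quad z(t,0)=z(t,1)=0,\quad z(0,x)=z_0(x),\quad y=z,$$ for $t\ge 0$, $x\in(0,1)$. Put $U_1=U_2=Y=X$, $B_1=B_2=C=I$, $N(z,y)=zy$ (pointwise product), and $A\varphi=i\varphi''-\varphi$ with domain $D(A)=\{\varphi\in H^3(0,1):\varphi,\varphi''\in H^1_0(0,1)\}$. **Theorem.** (1) With these spaces and operators the equation is a bilinear feedback system $$\dot z=Az+B_1u_1+B_2u_2,\quad z(0)=z_0,\quad y=Cz,\quad u_2=N(z,y),$$ that is: $A$ generates a $C_0$-semigroup $(T(t))_{t\ge0}$ on $X$; $B_1,B_2,C$ are bounded; $N:X\times Y\to U_2$ is well defined, continuous and bilinear, and for some $K>0$, $p\in(0,1)$ it satisfies $\|N(z,y)\|_{U_2}\le K\|z\|_X\|y\|_X^{1-p}\|y\|_Y^{p}$.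 The underlying linear system is well-posed: $B_1,B_2$ are $L^2$-admissible control operators, $C$ is an $L^2$-admissible observation operator, and the transfer functions $\alpha\mapsto C(\alpha-A)^{-1}B_i$ are bounded on some right half-plane. (2) There are constants $\omega,\varepsilon,c>0$ such that for all $z_0\in H^1_0(0,1)$ and all $u_1\in L^2_\omega(0,\infty;H^1_0(0,1))=\{u\in L^2(0,\infty;H^1_0(0,1)) : e^{\omega\cdot}u\in L^2(0,\infty;H^1_0(0,1))\}$ (with norm $\|u\|_{L^2_\omega}=\|e^{\omega\cdot}u\|_{L^2}$) satisfying $$\|z_0\|_{H^1_0(0,1)}+\|u_1\|_{L^2_\omega(0,\infty;H^1_0(0,1))}\le\varepsilon,$$ there is a unique mild solution $z\in C([0,\infty);H^1_0(0,1))$ with output $y\in L^2_{\rm loc}(0,\infty;H^1_0(0,1))$, i.e. $$z(t)=T(t)z_0+\int_0^tT(t-s)u_1(s)\,ds+\int_0^tT(t-s)N(z(s),y(s))\,ds\quad(t\ge0),\qquad y=Cz\ \text{ a.e.},$$ and it satisfies, for every $t\ge0$, $$\|z(t)\|_{H^1_0(0,1)}\le \|z_0\|_{H^1_0(0,1)}e^{-\omega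 t}+c\,e^{-\omega t}\,\|e^{\omega\cdot}u_1\|_{L^2(0,t;H^1_0(0,1))}.$$ (3) In particular, for this $\omega$ the system is locally $L^2_\omega$-input-to-state stable: there are $\beta\in\mathcal{KL}$, $\gamma\in\mathcal K_\infty$ and $\varepsilon'>0$ such that for all $z_0$, $u_1$ as above with $\|z_0\|+\|u_1\|_{L^2_\omega(0,\infty)}\le\varepsilon'$ there is a solution $z$ with $\|z(t)\|\le\beta(\|z_0\|,t)+\gamma(\|u_1\|_{L^2_\omega(0,t)})$ for all $t\ge0$. Here $\mathcal{KL}$ is the set of continuous $\beta:[0,\infty)^2\to[0,\infty)$ such that $\beta(\cdot,t)$ is strictly increasing with $\beta(0,t)=0$ for all $t\ge 0$ and $\beta(s,\cdot)$ is strictly decreasing to $0$ for all $s>0$; $\mathcal K_\infty$ is the set of continuous, strictly increasing, unbounded $\gamma:[0,\infty)\to[0,\infty)$ with $\gamma(0)=0$. -/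

import Mathlib

open MeasureTheory Set Filter Topology
open scoped NNReal ENNReal

noncomputable section

/-! ### The complex Sobolev space `H¹₀(0,1)` -/

/-- The complex Lebesgue space `L²(0,1)`. -/
abbrev L2I : Type := Lp ℂ 2 (volume.restrict (Ioo (0 : ℝ) 1))

/-- `φ ∈ C_c^∞(0,1)`, complex valued. -/
structure IsTestFunction (φ : ℝ → ℂ) : Prop where
  smooth : ContDiff ℝ (⊤ : ℕ∞) φ
  compact : HasCompactSupport φ
  support : tsupport φ ⊆ Ioo (0 : ℝ) 1

/-- `g` is the weak derivative of `f` on the interval `(0,1)`. -/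
def IsWeakDeriv (f g : L2I) : Prop :=
  ∀ φ : ℝ → ℂ, IsTestFunction φ →
    ∫ x in Ioo (0 : ℝ) 1, f x * deriv φ x = - ∫ x in Ioo (0 : ℝ) 1, g x * φ x

/-- The pairs `(φ, φ')` in `L²(0,1) × L²(0,1)` with `φ ∈ C_c^∞(0,1)`. -/
def testPairs : Submodule ℂ (L2I × L2I) where
  carrier := {p | ∃ φ : ℝ → ℂ, IsTestFunction φ ∧
    p.1 =ᵐ[volume.restrict (Ioo (0 : ℝ) 1)] φ ∧
    p.2 =ᵐ[volume.restrict (Ioo (0 : ℝ) 1)] deriv φ}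
  zero_mem' := by
    refine ⟨0, ⟨contDiff_const, HasCompactSupport.zero, by simp [tsupport]⟩, ?_, ?_⟩
    · exact Lp.coeFn_zero _ _ _
    · have h : deriv (0 : ℝ → ℂ) = 0 := by ext x; simp
      rw [h]; exact Lp.coeFn_zero _ _ _
  add_mem' := by
    rintro p q ⟨φ, hφ, h1, h2⟩ ⟨ψ, hψ, k1, k2⟩
    refine ⟨φ + ψ, ⟨hφ.smooth.add hψ.smooth, hφ.compact.add hψ.compact, ?_⟩, ?_, ?_⟩
    · exact (tsupport_add φ ψ).trans (union_subset hφ.support hψ.support)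
    · filter_upwards [Lp.coeFn_add p.1 q.1, h1, k1] with x hx h k
      rw [Prod.fst_add, hx, Pi.add_apply, h, k, Pi.add_apply]
    · filter_upwards [Lp.coeFn_add p.2 q.2, h2, k2] with x hx h k
      rw [Prod.snd_add, hx, Pi.add_apply, h, k]
      exact (deriv_add (hφ.smooth.differentiable (by simp) x)
        (hψ.smooth.differentiable (by simp) x)).symm
  smul_mem' := by
    rintro c p ⟨φ, hφ, h1, h2⟩
    refine ⟨c • φ, ⟨hφ.smooth.const_smul c, hφ.compact.smul_left (f := fun _ => c), ?_⟩, ?_, ?_⟩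
    · exact (tsupport_smul_subset_right (fun _ => c) φ).trans hφ.support
    · filter_upwards [Lp.coeFn_smul c p.1, h1] with x hx h
      simp [hx, h]
    · filter_upwards [Lp.coeFn_smul c p.2, h2] with x hx h
      rw [Prod.smul_snd, hx, Pi.smul_apply, h]
      exact (deriv_const_smul c (hφ.smooth.differentiable (by simp) x)).symm

/-- The Sobolev space `H¹₀(0,1)`: the closure of `C_c^∞(0,1)` in the `H¹`-topology. An element is
stored as the pair `(z, z')` of a function and its weak derivative. -/
def H01 : Type := ↥testPairs.topologicalClosure

namespace H01

instance : AddCommGroup H01 := inferInstanceAs (AddCommGroup ↥testPairs.topologicalClosure)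

instance : Module ℂ H01 := inferInstanceAs (Module ℂ ↥testPairs.topologicalClosure)

/-- The inclusion `H¹₀(0,1) → L²(0,1)`, i.e. `z` itself. -/
def fn : H01 →ₗ[ℂ] L2I :=
  LinearMap.fst ℂ L2I L2I ∘ₗ testPairs.topologicalClosure.subtype

/-- The weak derivative `z'` of `z ∈ H¹₀(0,1)`. -/
def dx : H01 →ₗ[ℂ] L2I :=
  LinearMap.snd ℂ L2I L2I ∘ₗ testPairs.topologicalClosure.subtype

/-- Poincaré's inequality for test functions. -/
theorem poincare_testPairs {p : L2I × L2I} (hp : p ∈ testPairs) : ‖p.1‖ ≤ ‖p.2‖ := by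
  obtain ⟨φ, hφ, h1, h2⟩ := hp
  have hprob : IsProbabilityMeasure (volume.restrict (Ioo (0 : ℝ) 1)) := ⟨by simp⟩
  rw [Lp.norm_def, Lp.norm_def]
  refine ENNReal.toReal_mono (Lp.eLpNorm_ne_top _) ?_
  rw [eLpNorm_congr_ae h1, eLpNorm_congr_ae h2]
  have hdc : Continuous (deriv φ) := hφ.smooth.continuous_deriv (by simp)
  have h0 : φ 0 = 0 := by
    by_contra h
    have := hφ.support (subset_tsupport φ (Function.mem_support.2 h))
    simp at this
  have hb : ∀ x ∈ Ioo (0 : ℝ) 1,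
      ‖φ x‖ₑ ≤ eLpNorm (deriv φ) 1 (volume.restrict (Ioo (0 : ℝ) 1)) := by
    intro x hx
    have hftc : ∫ s in (0 : ℝ)..x, deriv φ s = φ x := by
      rw [intervalIntegral.integral_deriv_eq_sub
        (fun s _ => hφ.smooth.differentiable (by simp) s) (hdc.intervalIntegrable _ _), h0, sub_zero]
    rw [← hftc, intervalIntegral.integral_of_le hx.1.le, eLpNorm_one_eq_lintegral_enorm]
    refine (enorm_integral_le_lintegral_enorm _).trans ?_
    refine lintegral_mono_set ?_
    intro s hs
    exact ⟨hs.1, lt_of_le_of_lt hs.2 hx.2⟩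
  calc eLpNorm φ 2 (volume.restrict (Ioo (0 : ℝ) 1))
      ≤ eLpNorm φ ∞ (volume.restrict (Ioo (0 : ℝ) 1)) :=
        eLpNorm_le_eLpNorm_of_exponent_le le_top hφ.smooth.continuous.aestronglyMeasurable
    _ ≤ eLpNorm (deriv φ) 1 (volume.restrict (Ioo (0 : ℝ) 1)) := by
        rw [eLpNorm_exponent_top]
        refine essSup_le_of_ae_le _ ?_
        filter_upwards [ae_restrict_mem measurableSet_Ioo] with x hx using hb x hx
    _ ≤ eLpNorm (deriv φ) 2 (volume.restrict (Ioo (0 : ℝ) 1)) :=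
        eLpNorm_le_eLpNorm_of_exponent_le (by norm_num) hdc.aestronglyMeasurable

/-- Poincaré's inequality on `H¹₀(0,1)`. -/
theorem poincare (z : H01) : ‖fn z‖ ≤ ‖dx z‖ := by
  have hcl : IsClosed {p : L2I × L2I | ‖p.1‖ ≤ ‖p.2‖} :=
    isClosed_le (by fun_prop) (by fun_prop)
  exact closure_minimal (fun p hp => poincare_testPairs hp) hcl z.2

theorem dx_injective : Function.Injective dx := by
  rw [← LinearMap.ker_eq_bot, LinearMap.ker_eq_bot']
  intro z hz
  have h := poincare z
  rw [hz, norm_zero] at h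
  have h' : fn z = 0 := norm_le_zero_iff.1 h
  exact Subtype.ext (Prod.ext h' hz)

/-- `H¹₀(0,1)` carries the norm `‖z‖ = ‖z'‖_{L²(0,1)}`. -/
instance : NormedAddCommGroup H01 := NormedAddCommGroup.induced H01 L2I dx dx_injective

instance : NormedSpace ℂ H01 := NormedSpace.induced ℂ H01 L2I dx

theorem norm_eq (z : H01) : ‖z‖ = ‖dx z‖ := rfl

instance : CompleteSpace H01 := by
  refine Metric.complete_of_cauchySeq_tendsto fun u hu => ?_
  have hpair : CauchySeq fun n => ((u n).1 : L2I × L2I) := by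
    rw [Metric.cauchySeq_iff'] at hu ⊢
    intro ε hε
    obtain ⟨N, hN⟩ := hu ε hε
    refine ⟨N, fun n hn => ?_⟩
    have h := hN n hn
    rw [dist_eq_norm, norm_eq] at h
    have h2 := (poincare (u n - u N)).trans_lt h
    rw [dist_eq_norm, Prod.norm_def]
    exact max_lt h2 h
  obtain ⟨p, hp⟩ := cauchySeq_tendsto_of_complete hpair
  have hmem : p ∈ testPairs.topologicalClosure :=
    (Submodule.isClosed_topologicalClosure testPairs).mem_of_tendsto hp
      (Eventually.of_forall fun n => (u n).2)
  let v : H01 := (⟨p, hmem⟩ : ↥testPairs.topologicalClosure)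
  refine ⟨v, ?_⟩
  rw [tendsto_iff_norm_sub_tendsto_zero]
  have h2 := (continuous_snd.tendsto p).comp hp
  rw [tendsto_iff_norm_sub_tendsto_zero] at h2
  exact h2

end H01

/-! ### Bilinear feedback systems -/

/-- A `C₀`-semigroup on `X` (the values at negative times are irrelevant). -/
structure C0Semigroup (X : Type*) [NormedAddCommGroup X] [NormedSpace ℂ X] where
  op : ℝ → X →L[ℂ] X
  op_zero : op 0 = ContinuousLinearMap.id ℂ X
  op_add : ∀ s t : ℝ, 0 ≤ s → 0 ≤ t → op (s + t) = (op s).comp (op t)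
  continuousOn : ∀ x : X, ContinuousOn (fun t => op t x) (Ici 0)

/-- `A` (with its domain) is the infinitesimal generator of the semigroup `T`. -/
def IsGenerator {X : Type*} [NormedAddCommGroup X] [NormedSpace ℂ X]
    (A : X →ₗ.[ℂ] X) (T : C0Semigroup X) : Prop :=
  ∀ x y : X, (x, y) ∈ A.graph ↔
    Tendsto (fun t : ℝ => t⁻¹ • (T.op t x - x)) (𝓝[>] 0) (𝓝 y)

/-- `R = (α - A)⁻¹` is the resolvent of `A` at `α`. -/
def IsResolventAt {X : Type*} [NormedAddCommGroup X] [NormedSpace ℂ X]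
    (A : X →ₗ.[ℂ] X) (α : ℂ) (R : X →L[ℂ] X) : Prop :=
  (∀ x : A.domain, R (α • (x : X) - A x) = x) ∧
    ∀ x : X, ∃ h : R x ∈ A.domain, α • R x - A ⟨R x, h⟩ = x

/-- A bilinear feedback system
`z' = A z + B₁ u₁ + B₂ u₂`, `z(0) = z₀`, `y = C z`, `u₂ = N(z, y)`
with state space `X`, input spaces `U₁`, `U₂` and output space `Y` (continuously embedded in `X`
by `emb`), in the case that `B₁`, `B₂` and `C` are bounded: `B₁`, `B₂` map into `X` itself, and
`C` is defined on all of `X`, with values in `Y`. -/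
structure BilinearFeedbackSystem (X U₁ U₂ Y : Type*)
    [NormedAddCommGroup X] [NormedSpace ℂ X] [CompleteSpace X]
    [NormedAddCommGroup U₁] [NormedSpace ℂ U₁] [CompleteSpace U₁]
    [NormedAddCommGroup U₂] [NormedSpace ℂ U₂] [CompleteSpace U₂]
    [NormedAddCommGroup Y] [NormedSpace ℂ Y] [CompleteSpace Y] where
  /-- the generator -/
  A : X →ₗ.[ℂ] X
  /-- the semigroup generated by `A` -/
  T : C0Semigroup X
  isGenerator : IsGenerator A T
  /-- the control operators -/
  B₁ : U₁ →L[ℂ] X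
  B₂ : U₂ →L[ℂ] X
  /-- the observation operator -/
  C : X →L[ℂ] Y
  /-- the embedding of the output space into the state space -/
  emb : Y →L[ℂ] X
  emb_injective : Function.Injective emb
  /-- the continuous bilinear feedback law -/
  N : X →L[ℂ] Y →L[ℂ] U₂
  N_bound : ∃ K > 0, ∃ p ∈ Ioo (0 : ℝ) 1, ∀ (z : X) (y : Y),
    ‖N z y‖ ≤ K * ‖z‖ * ‖emb y‖ ^ (1 - p) * ‖y‖ ^ p

/-- `e^{ω·} u`. -/
def expWeight {U : Type*} [NormedAddCommGroup U] [NormedSpace ℂ U]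
    (ω : ℝ) (u : ℝ → U) : ℝ → U :=
  fun t => Real.exp (ω * t) • u t

/-- `u ∈ L²_ω(0,∞;U)`. -/
def MemL2w {U : Type*} [NormedAddCommGroup U] [NormedSpace ℂ U] (ω : ℝ) (u : ℝ → U) : Prop :=
  MemLp u 2 (volume.restrict (Ioi 0)) ∧ MemLp (expWeight ω u) 2 (volume.restrict (Ioi 0))

/-- The norm of `u` in `L²_ω(J;U)`, that is, `‖e^{ω·} u‖_{L²(J;U)}`, for an interval `J`. -/
def l2wNorm {U : Type*} [NormedAddCommGroup U] [NormedSpace ℂ U]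
    (ω : ℝ) (J : Set ℝ) (u : ℝ → U) : ℝ≥0 :=
  (eLpNorm (expWeight ω u) 2 (volume.restrict J)).toNNReal

/-- Comparison functions of class `𝒦ℒ`. -/
structure IsClassKL (β : ℝ≥0 → ℝ≥0 → ℝ≥0) : Prop where
  continuous : Continuous (Function.uncurry β)
  strictMono : ∀ t, StrictMono fun s => β s t
  zero : ∀ t, β 0 t = 0
  strictAnti : ∀ s, 0 < s → StrictAnti (β s)
  tendsto : ∀ s, 0 < s → Tendsto (β s) atTop (𝓝 0)

/-- Comparison functions of class `𝒦_∞`. -/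
structure IsClassKInfty (γ : ℝ≥0 → ℝ≥0) : Prop where
  continuous : Continuous γ
  strictMono : StrictMono γ
  zero : γ 0 = 0
  tendsto : Tendsto γ atTop atTop

namespace BilinearFeedbackSystem

variable {X U₁ U₂ Y : Type*}
    [NormedAddCommGroup X] [NormedSpace ℂ X] [CompleteSpace X]
    [NormedAddCommGroup U₁] [NormedSpace ℂ U₁] [CompleteSpace U₁]
    [NormedAddCommGroup U₂] [NormedSpace ℂ U₂] [CompleteSpace U₂]
    [NormedAddCommGroup Y] [NormedSpace ℂ Y] [CompleteSpace Y]

/-- The input map `Φ_t u = ∫₀ᵗ T(t - s) B u(s) ds` belonging to a control operator `B`. -/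
def inputMap (S : BilinearFeedbackSystem X U₁ U₂ Y) {U : Type*} [NormedAddCommGroup U]
    [NormedSpace ℂ U] (B : U →L[ℂ] X) (t : ℝ) (u : ℝ → U) : X :=
  ∫ s in (0 : ℝ)..t, S.T.op (t - s) (B (u s))

/-- The output map `(Ψ x)(t) = C T(t) x`. -/
def outputMap (S : BilinearFeedbackSystem X U₁ U₂ Y) (x : X) (t : ℝ) : Y :=
  S.C (S.T.op t x)

/-- The input-output map `(𝔽 u)(t) = C ∫₀ᵗ T(t - s) B u(s) ds` belonging to the transfer function
`C (α - A)⁻¹ B`. -/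
def inputOutputMap (S : BilinearFeedbackSystem X U₁ U₂ Y) {U : Type*} [NormedAddCommGroup U]
    [NormedSpace ℂ U] (B : U →L[ℂ] X) (u : ℝ → U) (t : ℝ) : Y :=
  S.C (S.inputMap B t u)

/-- `B` is an `L²`-admissible control operator. -/
def AdmissibleControl (S : BilinearFeedbackSystem X U₁ U₂ Y) {U : Type*} [NormedAddCommGroup U]
    [NormedSpace ℂ U] (B : U →L[ℂ] X) : Prop :=
  ∀ t > 0, ∃ k : ℝ, ∀ u : ℝ → U, MemLp u 2 (volume.restrict (Ioi 0)) →
    ‖S.inputMap B t u‖ ≤ k * (eLpNorm u 2 (volume.restrict (Ioi 0))).toReal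

/-- `C` is an `L²`-admissible observation operator. -/
def AdmissibleObservation (S : BilinearFeedbackSystem X U₁ U₂ Y) : Prop :=
  ∀ t > 0, ∃ k : ℝ, ∀ x : X, MemLp (S.outputMap x) 2 (volume.restrict (Ioo 0 t)) ∧
    (eLpNorm (S.outputMap x) 2 (volume.restrict (Ioo 0 t))).toReal ≤ k * ‖x‖

/-- The transfer function `α ↦ C (α - A)⁻¹ B` is defined and bounded on some right half-plane. -/
def BoundedTransfer (S : BilinearFeedbackSystem X U₁ U₂ Y) {U : Type*} [NormedAddCommGroup U]
    [NormedSpace ℂ U] (B : U →L[ℂ] X) : Prop :=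
  ∃ a M : ℝ, ∀ α : ℂ, a < α.re →
    ∃ R : X →L[ℂ] X, IsResolventAt S.A α R ∧ ‖S.C.comp (R.comp B)‖ ≤ M

/-- The underlying linear system `x' = A x + B₁ u₁ + B₂ u₂`, `y = C x` is well-posed. -/
structure LinearWellPosed (S : BilinearFeedbackSystem X U₁ U₂ Y) : Prop where
  control₁ : S.AdmissibleControl S.B₁
  control₂ : S.AdmissibleControl S.B₂
  observation : S.AdmissibleObservation
  transfer₁ : S.BoundedTransfer S.B₁
  transfer₂ : S.BoundedTransfer S.B₂

/-- `z ∈ C([0,∞);X)` and `y ∈ L²_loc(0,∞;Y)` are a solution and output of the bilinear feedback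
system with input data `z₀` and `u₁`. -/
structure IsSolution (S : BilinearFeedbackSystem X U₁ U₂ Y)
    (z₀ : X) (u₁ : ℝ → U₁) (z : ℝ → X) (y : ℝ → Y) : Prop where
  continuousOn : ContinuousOn z (Ici 0)
  memLp_output : ∀ t > 0, MemLp y 2 (volume.restrict (Ioo 0 t))
  state_eq : ∀ t ≥ 0, z t =
    S.T.op t z₀ + S.inputMap S.B₁ t u₁ + S.inputMap S.B₂ t (fun s => S.N (z s) (y s))
  output_eq : ∀ᵐ t ∂(volume.restrict (Ioi (0 : ℝ))), y t =
    S.outputMap z₀ t + S.inputOutputMap S.B₁ u₁ t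
      + S.inputOutputMap S.B₂ (fun s => S.N (z s) (y s)) t

/-- The bilinear feedback system is locally `L²_ω`-input-to-state stable. -/
def LocallyL2wISS (S : BilinearFeedbackSystem X U₁ U₂ Y) (ω : ℝ) : Prop :=
  ∃ β γ, IsClassKL β ∧ IsClassKInfty γ ∧ ∃ ε : ℝ, 0 < ε ∧
    ∀ (z₀ : X) (u₁ : ℝ → U₁), MemL2w ω u₁ → ‖z₀‖ + l2wNorm ω (Ioi 0) u₁ ≤ ε →
      ∃ z y, S.IsSolution z₀ u₁ z y ∧
        ∀ t : ℝ≥0, ‖z t‖₊ ≤ β ‖z₀‖₊ t + γ (l2wNorm ω (Ioo 0 t) u₁)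

end BilinearFeedbackSystem

/-! ### The damped Schrödinger equation with quadratic nonlinearity -/

/-- `A φ = i φ'' - φ` with domain `{φ ∈ H³(0,1) | φ, φ'' ∈ H¹₀(0,1)}`; for `φ ∈ H¹₀(0,1)`, having
a second weak derivative `ψ` in `H¹₀(0,1)` already implies `φ ∈ H³(0,1)`. -/
def IsSchrodingerOperator (A : H01 →ₗ.[ℂ] H01) : Prop :=
  ∀ φ η : H01, (φ, η) ∈ A.graph ↔
    ∃ ψ : H01, IsWeakDeriv (H01.dx φ) (H01.fn ψ) ∧ η = Complex.I • ψ - φ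

/-- `S` is the system `z' = i z_xx - z + z² + u₁`, `z(t,0) = z(t,1) = 0`, `y = z`: all spaces are
`H¹₀(0,1)`, `A φ = i φ'' - φ`, `B₁ = B₂ = C = I` and `N(z, y)` is the pointwise product `z y`. -/
structure IsSchrodingerSystem (S : BilinearFeedbackSystem H01 H01 H01 H01) : Prop where
  A_eq : IsSchrodingerOperator S.A
  B₁_eq : S.B₁ = ContinuousLinearMap.id ℂ H01
  B₂_eq : S.B₂ = ContinuousLinearMap.id ℂ H01
  C_eq : S.C = ContinuousLinearMap.id ℂ H01
  emb_eq : S.emb = ContinuousLinearMap.id ℂ H01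
  N_eq : ∀ z y : H01, (H01.fn (S.N z y) : ℝ → ℂ)
    =ᵐ[volume.restrict (Ioo (0 : ℝ) 1)] fun x => H01.fn z x * H01.fn y x

end

/-!
The functions `√2 sin(kπx) / (kπ)`, `k ≥ 1`, form a Hilbert basis of `H¹₀(0,1)` for the inner product
`⟨z', y'⟩_{L²}` (`H01.sineBasis`). They lie in `H¹₀` because a smooth function vanishing at the
endpoints is an `H¹` limit of cutoffs of itself (`contL2_pair_mem_closure`). They are complete because
a function of `L²(0,1)` orthogonal to every `cos(kπx)`, `k ≥ 0`, is orthogonal to all polynomials in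
`cos(πx)`, hence zero (`L2I.eq_zero_of_integral_cos_eq_zero`). Integrating by parts twice shows that
`A φ = i φ'' - φ`, with its weakly defined domain, is the maximal diagonal operator with eigenvalues
`-i(kπ)² - 1` (`isSchrodingerOperator_diagonalPMap`). These all have real part `-1`, so `A` generates
a group with `‖T(t)‖ ≤ e^{-t}` for all real `t`, and its resolvent is bounded by one on the right
half-plane; this settles generation and well-posedness. The product is bounded on `H¹₀(0,1)` with
constant `2` because an element of `H¹₀` is the primitive of its derivative (`H01.mul`).

The nonlinear part uses only a damped group and a bounded bilinear map. The group decays faster than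
`e^{-t/2}` and the nonlinearity preserves this weight, so for small data the variation of constants
formula is a contraction in the space of functions with `e^{t/2} ‖z(t)‖` bounded on all of `[0,∞)`
(`DampedGroup.exists_isMild`).
Evaluating the formula at a maximum point of `e^{s/2} ‖z(s)‖` over `[0,t]` gives the decay estimate
with constant one in front of `‖z₀‖`: the loss `1 - e^{-τ/2}` from the nonlinear term is absorbed by
the gain in `e^{τ/2} ‖T(τ) z₀‖ ≤ e^{-τ/2} ‖z₀‖` (`DampedGroup.IsMild.norm_le`). Uniqueness among all
solutions, small or not, is an integral Grönwall argument (`DampedGroup.IsMild.eqOn`). With `ω = 1/2`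
the estimate is already the input-to-state stability bound with `β(s,t) = s e^{-t/2}` and `γ(s) = 2s`.
-/

noncomputable section


/-! ### Diagonal operators on a Hilbert space -/

section Diagonal

variable {H ι : Type*} [NormedAddCommGroup H] [InnerProductSpace ℂ H]

theorem HilbertBasis.hasSum_norm_sq_repr (b : HilbertBasis ι ℂ H) (x : H) :
    HasSum (fun i => ‖b.repr x i‖ ^ 2) (‖x‖ ^ 2) := by
  have h := lp.hasSum_norm (p := 2) (by norm_num) (b.repr x)
  simpa using h

theorem HilbertBasis.ext_repr (b : HilbertBasis ι ℂ H) {x y : H}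
    (h : ∀ i, b.repr x i = b.repr y i) : x = y :=
  b.repr.injective (lp.ext (funext h))

/-- A bounded sequence of multipliers defines a bounded diagonal operator. -/
theorem HilbertBasis.exists_diagonal (b : HilbertBasis ι ℂ H) (m : ι → ℂ) {C : ℝ} (hC0 : 0 ≤ C)
    (hC : ∀ i, ‖m i‖ ≤ C) :
    ∃ M : H →L[ℂ] H, (∀ x i, b.repr (M x) i = m i * b.repr x i) ∧ ‖M‖ ≤ C := by
  have hle : ∀ x i, ‖m i * b.repr x i‖ ^ 2 ≤ C ^ 2 * ‖b.repr x i‖ ^ 2 := fun x i => by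
    rw [norm_mul, mul_pow]; gcongr; exact hC i
  have hs : ∀ x : H, Summable fun i => C ^ 2 * ‖b.repr x i‖ ^ 2 := fun x =>
    (b.hasSum_norm_sq_repr x).summable.mul_left _
  have hmem : ∀ x : H, Memℓp (fun i => m i * b.repr x i) 2 := fun x => by
    refine memℓp_gen ?_
    simpa using Summable.of_nonneg_of_le (fun i => by positivity) (hle x) (hs x)
  let L : H →ₗ[ℂ] H :=
    { toFun := fun x => b.repr.symm ⟨fun i => m i * b.repr x i, hmem x⟩
      map_add' := fun x y => by
        refine b.ext_repr fun i => ?_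
        simp [mul_add]
        rfl
      map_smul' := fun c x => by
        refine b.ext_repr fun i => ?_
        simp [mul_left_comm] }
  have hL : ∀ x i, b.repr (L x) i = m i * b.repr x i := fun x i => by simp [L]
  refine ⟨L.mkContinuous C fun x => ?_, hL, LinearMap.mkContinuous_norm_le _ hC0 _⟩
  refine le_of_sq_le_sq ?_ (by positivity)
  rw [mul_pow]
  refine hasSum_le (fun i => ?_) (b.hasSum_norm_sq_repr (L x))
    ((b.hasSum_norm_sq_repr x).mul_left _)
  rw [hL]
  exact hle x i

end Diagonal

/-- A strongly continuous one-parameter group of bounded operators with `‖T(t)‖ ≤ e^{-t}` for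
all real `t`, negative ones included. -/
structure DampedGroup (X : Type*) [NormedAddCommGroup X] [NormedSpace ℂ X] where
  op : ℝ → X →L[ℂ] X
  op_zero : op 0 = ContinuousLinearMap.id ℂ X
  op_add : ∀ s t : ℝ, op (s + t) = (op s).comp (op t)
  norm_le : ∀ t : ℝ, ‖op t‖ ≤ Real.exp (-t)
  continuous_orbit : ∀ x : X, Continuous fun t => op t x

namespace DampedGroup

variable {X : Type*} [NormedAddCommGroup X] [NormedSpace ℂ X] (T : DampedGroup X)

theorem norm_op_apply_le (t : ℝ) (x : X) : ‖T.op t x‖ ≤ Real.exp (-t) * ‖x‖ :=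
  (T.op t).le_of_opNorm_le (T.norm_le t) x

theorem continuous_uncurry : Continuous fun p : ℝ × X => T.op p.1 p.2 := by
  rw [continuous_iff_continuousAt]
  rintro ⟨t, x⟩
  rw [ContinuousAt, tendsto_iff_norm_sub_tendsto_zero]
  have h1 : Tendsto (fun p : ℝ × X => Real.exp (-p.1) * ‖p.2 - x‖ + ‖T.op p.1 x - T.op t x‖)
      (𝓝 (t, x)) (𝓝 (Real.exp (-t) * ‖x - x‖ + ‖T.op t x - T.op t x‖)) := by
    have hc : Continuous fun p : ℝ × X =>
        Real.exp (-p.1) * ‖p.2 - x‖ + ‖T.op p.1 x - T.op t x‖ := by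
      have := (T.continuous_orbit x).comp (continuous_fst : Continuous (Prod.fst : ℝ × X → ℝ))
      simp only [Function.comp_def] at this
      fun_prop
    exact hc.tendsto (t, x)
  simp only [sub_self, norm_zero, mul_zero, add_zero] at h1
  refine squeeze_zero (fun _ => norm_nonneg _) (fun p => ?_) h1
  have : T.op p.1 p.2 - T.op t x = T.op p.1 (p.2 - x) + (T.op p.1 x - T.op t x) := by
    rw [map_sub]; abel
  rw [this]
  exact (norm_add_le _ _).trans (add_le_add (T.norm_op_apply_le _ _) le_rfl)

/-- The restriction of the group to nonnegative times. -/
def toC0Semigroup : C0Semigroup X where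
  op := T.op
  op_zero := T.op_zero
  op_add s t _ _ := T.op_add s t
  continuousOn x := (T.continuous_orbit x).continuousOn

end DampedGroup

/-! ### The group generated by a diagonal operator -/

section DiagonalGroup

variable {H ι : Type*} [NormedAddCommGroup H] [InnerProductSpace ℂ H]

/-- The graph of the maximal diagonal operator with eigenvalues `l i` on a Hilbert basis. -/
def HilbertBasis.diagonalGraph (b : HilbertBasis ι ℂ H) (l : ι → ℂ) : Submodule ℂ (H × H) where
  carrier := {p | ∀ i, b.repr p.2 i = l i * b.repr p.1 i}
  zero_mem' := by simp
  add_mem' := by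
    intro p q hp hq i
    simp [hp i, hq i, mul_add]
  smul_mem' := by
    intro c p hp i
    simp [hp i, mul_left_comm]

/-- The maximal diagonal operator as a partially defined linear map. -/
def HilbertBasis.diagonalPMap (b : HilbertBasis ι ℂ H) (l : ι → ℂ) : H →ₗ.[ℂ] H :=
  (b.diagonalGraph l).toLinearPMap

theorem HilbertBasis.mem_graph_diagonalPMap (b : HilbertBasis ι ℂ H) (l : ι → ℂ) (x y : H) :
    (x, y) ∈ (b.diagonalPMap l).graph ↔ ∀ i, b.repr y i = l i * b.repr x i := by
  rw [diagonalPMap, Submodule.toLinearPMap_graph_eq]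
  · rfl
  · intro p hp h0
    refine b.ext_repr fun i => ?_
    have := hp i
    rw [h0] at this
    simpa using this

/-- A diagonal operator whose eigenvalues lie on the line `Re l = -1` generates a damped group. -/
theorem HilbertBasis.exists_dampedGroup (b : HilbertBasis ι ℂ H) (l : ι → ℂ)
    (hl : ∀ i, (l i).re = -1) :
    ∃ T : DampedGroup H, ∀ t x i, b.repr (T.op t x) i = Complex.exp (l i * t) * b.repr x i := by
  have hn : ∀ (t : ℝ) i, ‖Complex.exp (l i * t)‖ = Real.exp (-t) := fun t i => by
    rw [Complex.norm_exp]; simp [hl]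
  have h := fun t : ℝ => b.exists_diagonal (fun i => Complex.exp (l i * t))
    (Real.exp_pos (-t)).le fun i => (hn t i).le
  choose op hop hop' using h
  refine ⟨⟨op, ?_, ?_, hop', ?_⟩, hop⟩
  · ext x
    refine b.ext_repr fun i => ?_
    simp [hop]
  · intro s t
    ext x
    refine b.ext_repr fun i => ?_
    simp [hop, mul_add, Complex.exp_add, mul_assoc]
  · intro x
    rw [continuous_iff_continuousAt]
    intro s
    rw [ContinuousAt, tendsto_iff_norm_sub_tendsto_zero]
    have key : Tendsto (fun t : ℝ => ‖op t x - op s x‖ ^ 2) (𝓝 s) (𝓝 0) := by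
      have h1 : ∀ t : ℝ, ‖op t x - op s x‖ ^ 2 =
          ∑' i, ‖Complex.exp (l i * t) - Complex.exp (l i * s)‖ ^ 2 * ‖b.repr x i‖ ^ 2 := by
        intro t
        rw [← (b.hasSum_norm_sq_repr _).tsum_eq]
        refine tsum_congr fun i => ?_
        rw [map_sub, lp.coeFn_sub, Pi.sub_apply, hop, hop, ← sub_mul, norm_mul, mul_pow]
      simp only [h1]
      have h0 : (0 : ℝ) = ∑' i : ι, (0 : ℝ) := by simp
      rw [h0]
      -- near `s` the multipliers are bounded by `exp (1 - s)`, which gives a summable majorant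
      refine tendsto_tsum_of_dominated_convergence
        (bound := fun i => (Real.exp (1 - s) + Real.exp (-s)) ^ 2 * ‖b.repr x i‖ ^ 2)
        ((b.hasSum_norm_sq_repr x).summable.mul_left _) ?_ ?_
      · intro i
        have hc : Continuous fun t : ℝ =>
            ‖Complex.exp (l i * t) - Complex.exp (l i * s)‖ ^ 2 * ‖b.repr x i‖ ^ 2 := by
          fun_prop
        simpa using hc.tendsto s
      · have : ∀ᶠ t : ℝ in 𝓝 s, s - 1 < t := lt_mem_nhds (by linarith)
        filter_upwards [this] with t ht i
        rw [Real.norm_of_nonneg (by positivity)]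
        gcongr
        refine (norm_sub_le _ _).trans ?_
        rw [hn, hn]
        gcongr
        linarith
    have := key.sqrt
    simpa [Real.sqrt_sq (norm_nonneg _)] using this

theorem HilbertBasis.isGenerator_diagonalPMap [CompleteSpace H] (b : HilbertBasis ι ℂ H)
    (l : ι → ℂ) (T : DampedGroup H)
    (hT : ∀ t x i, b.repr (T.op t x) i = Complex.exp (l i * t) * b.repr x i) :
    IsGenerator (b.diagonalPMap l) T.toC0Semigroup := by
  have hd : ∀ i (t : ℝ), HasDerivAt (fun s : ℝ => Complex.exp (l i * s))
      (Complex.exp (l i * t) * l i) t := fun i t => by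
    have h := (((hasDerivAt_id (t : ℂ)).const_mul (l i)).cexp).comp_ofReal
    simpa using h
  let coord : ι → H →L[ℂ] ℂ := fun i => innerSL ℂ (b i)
  have hcoord : ∀ i x, coord i x = b.repr x i := fun i x => (b.repr_apply_apply x i).symm
  intro x y
  rw [b.mem_graph_diagonalPMap]
  change _ ↔ Tendsto (fun t : ℝ => t⁻¹ • (T.op t x - x)) (𝓝[>] 0) (𝓝 y)
  constructor
  · intro h
    -- comparing coordinates, `T(t)x - x = ∫₀ᵗ T(s)y ds`
    have hint : ∀ t : ℝ, T.op t x - x = ∫ s in (0 : ℝ)..t, T.op s y := by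
      intro t
      refine b.ext_repr fun i => ?_
      rw [← hcoord, ← hcoord, ← (coord i).intervalIntegral_comp_comm
        ((T.continuous_orbit y).intervalIntegrable _ _)]
      have : ∀ s : ℝ, coord i (T.op s y) = Complex.exp (l i * s) * l i * b.repr x i := fun s => by
        rw [hcoord, hT, h i, mul_assoc]
      simp only [this]
      rw [intervalIntegral.integral_eq_sub_of_hasDerivAt
        (f := fun s : ℝ => Complex.exp (l i * s) * b.repr x i)
        (fun s _ => (hd i s).mul_const _) (Continuous.intervalIntegrable (by fun_prop) _ _)]
      rw [map_sub, hcoord, hcoord, hT]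
      simp
    have hder : HasDerivAt (fun t : ℝ => ∫ s in (0 : ℝ)..t, T.op s y) (T.op 0 y) 0 :=
      ((T.continuous_orbit y).integral_hasStrictDerivAt 0 0).hasDerivAt
    have := hder.tendsto_slope_zero_right
    simpa [← hint, T.op_zero] using this
  · intro h i
    have h1 : Tendsto (fun t : ℝ => coord i (t⁻¹ • (T.op t x - x))) (𝓝[>] 0) (𝓝 (coord i y)) :=
      ((coord i).continuous.tendsto y).comp h
    have h2 : Tendsto (fun t : ℝ => coord i (t⁻¹ • (T.op t x - x))) (𝓝[>] 0)
        (𝓝 (l i * b.repr x i)) := by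
      have h3 := ((hd i 0).mul_const (b.repr x i)).tendsto_slope_zero_right
      simp only [zero_add, Complex.ofReal_zero, mul_zero, Complex.exp_zero, one_mul] at h3
      refine h3.congr fun t => ?_
      rw [ContinuousLinearMap.map_smul_of_tower, map_sub, hcoord, hcoord, hT]
    rw [← hcoord]
    exact tendsto_nhds_unique h1 h2

/-- A diagonal operator with eigenvalues on `Re l = -1` has a resolvent of norm at most one on the
right half-plane. -/
theorem HilbertBasis.exists_isResolventAt_diagonalPMap (b : HilbertBasis ι ℂ H) (l : ι → ℂ)
    (hl : ∀ i, (l i).re = -1) {α : ℂ} (hα : 0 < α.re) :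
    ∃ R : H →L[ℂ] H, IsResolventAt (b.diagonalPMap l) α R ∧ ‖R‖ ≤ 1 := by
  have hre : ∀ i, 1 ≤ ‖α - l i‖ := fun i => by
    refine le_trans ?_ ((le_abs_self _).trans (Complex.abs_re_le_norm _))
    rw [Complex.sub_re, hl]
    linarith
  have hne : ∀ i, α - l i ≠ 0 := fun i h => by
    have := hre i
    rw [h, norm_zero] at this
    linarith
  obtain ⟨R, hR, hR1⟩ := b.exists_diagonal (fun i => (α - l i)⁻¹) zero_le_one fun i => by
    rw [norm_inv]; exact inv_le_one_of_one_le₀ (hre i)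
  refine ⟨R, ⟨fun x => ?_, fun x => ?_⟩, hR1⟩
  · have hx := (b.mem_graph_diagonalPMap l x _).1 ((b.diagonalPMap l).mem_graph x)
    refine b.ext_repr fun i => ?_
    rw [hR, map_sub, map_smul, lp.coeFn_sub, Pi.sub_apply, hx, lp.coeFn_smul, Pi.smul_apply,
      smul_eq_mul, ← sub_mul, inv_mul_cancel_left₀ (hne i)]
  · have hg : (R x, α • R x - x) ∈ (b.diagonalPMap l).graph := by
      rw [b.mem_graph_diagonalPMap]
      intro i
      have := hne i
      rw [map_sub, map_smul, lp.coeFn_sub, Pi.sub_apply, lp.coeFn_smul, Pi.smul_apply,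
        smul_eq_mul, hR]
      field_simp
      ring
    obtain ⟨z, hz1, hz2⟩ := (LinearPMap.mem_graph_iff _).1 hg
    simp only at hz1 hz2
    have hdom : R x ∈ (b.diagonalPMap l).domain := hz1 ▸ z.2
    refine ⟨hdom, ?_⟩
    have : z = ⟨R x, hdom⟩ := Subtype.ext hz1
    rw [← this, hz2]
    abel

end DiagonalGroup


/-! ### The Duhamel integral of a damped group -/

namespace DampedGroup

variable {X : Type*} [NormedAddCommGroup X] [NormedSpace ℂ X] (T : DampedGroup X)

theorem intervalIntegrable_op_sub {f : ℝ → X} {a b : ℝ} (hf : IntervalIntegrable f volume a b)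
    (t : ℝ) : IntervalIntegrable (fun s => T.op (t - s) (f s)) volume a b := by
  have hmaj : IntervalIntegrable (fun s => Real.exp (-(t - s)) * ‖f s‖) volume a b :=
    hf.norm.continuousOn_mul (by fun_prop)
  refine hmaj.mono_fun ?_ (ae_of_all _ fun s => ?_)
  · exact T.continuous_uncurry.comp_aestronglyMeasurable
      ((by fun_prop : Continuous fun s : ℝ => t - s).aestronglyMeasurable.prodMk
        hf.aestronglyMeasurable_restrict_uIoc)
  · beta_reduce
    rw [Real.norm_of_nonneg (by positivity)]
    exact T.norm_op_apply_le _ _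

/-- The convolution `∫₀ᵗ T(t - s) f(s) ds`. -/
def duhamel (f : ℝ → X) (t : ℝ) : X :=
  ∫ s in (0 : ℝ)..t, T.op (t - s) (f s)

theorem norm_duhamel_le {f : ℝ → X} {t : ℝ} {g : ℝ → ℝ} (ht : 0 ≤ t)
    (hg : IntervalIntegrable g volume 0 t)
    (hfg : ∀ s ∈ Ioc 0 t, Real.exp (-(t - s)) * ‖f s‖ ≤ g s) :
    ‖T.duhamel f t‖ ≤ ∫ s in (0 : ℝ)..t, g s := by
  refine intervalIntegral.norm_integral_le_of_norm_le ht (ae_of_all _ fun s hs => ?_) hg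
  exact (T.norm_op_apply_le _ _).trans (hfg s hs)

theorem duhamel_sub {f g : ℝ → X} {t : ℝ} (hf : IntervalIntegrable f volume 0 t)
    (hg : IntervalIntegrable g volume 0 t) :
    T.duhamel f t - T.duhamel g t = T.duhamel (fun s => f s - g s) t := by
  rw [duhamel, duhamel, duhamel, ← intervalIntegral.integral_sub
    (T.intervalIntegrable_op_sub hf t) (T.intervalIntegrable_op_sub hg t)]
  simp

theorem duhamel_congr_ae {f g : ℝ → X} {t : ℝ} (ht : 0 ≤ t)
    (h : f =ᵐ[volume.restrict (Ioi (0 : ℝ))] g) : T.duhamel f t = T.duhamel g t := by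
  rw [duhamel, duhamel, intervalIntegral.integral_of_le ht, intervalIntegral.integral_of_le ht]
  refine integral_congr_ae ?_
  filter_upwards [ae_restrict_of_ae_restrict_of_subset Ioc_subset_Ioi_self h] with s hs
  rw [hs]

/-- By the group law the Duhamel integral is `T(t) ∫₀ᵗ T(-s) f(s) ds`, a continuous function. -/
theorem continuousOn_duhamel [CompleteSpace X] {f : ℝ → X}
    (hf : ∀ t, 0 ≤ t → IntervalIntegrable f volume 0 t) : ContinuousOn (T.duhamel f) (Ici 0) := by
  have heq : ∀ t, 0 ≤ t → T.duhamel f t = T.op t (∫ s in (0 : ℝ)..t, T.op (0 - s) (f s)) := by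
    intro t ht
    rw [← ContinuousLinearMap.intervalIntegral_comp_comm _
      (T.intervalIntegrable_op_sub (hf t ht) 0), duhamel]
    refine intervalIntegral.integral_congr fun s _ => ?_
    rw [← ContinuousLinearMap.comp_apply, ← T.op_add]
    ring_nf
  refine ContinuousOn.congr ?_ heq
  have hprim : ContinuousOn (fun t : ℝ => ∫ s in (0 : ℝ)..t, T.op (0 - s) (f s)) (Ici 0) := by
    intro t ht
    have ht' : (0 : ℝ) ≤ t := ht
    have h1 : ContinuousOn (fun t : ℝ => ∫ s in (0 : ℝ)..t, T.op (0 - s) (f s))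
        (uIcc 0 (t + 1)) := by
      refine intervalIntegral.continuousOn_primitive_interval ?_
      rw [uIcc_of_le (by linarith), integrableOn_Icc_iff_integrableOn_Ioc,
        ← intervalIntegrable_iff_integrableOn_Ioc_of_le (by linarith)]
      exact T.intervalIntegrable_op_sub (hf _ (by linarith)) 0
    rw [uIcc_of_le (by linarith)] at h1
    refine (h1 t ⟨ht', by linarith⟩).mono_of_mem_nhdsWithin ?_
    rw [← Ici_inter_Iic]
    exact inter_mem self_mem_nhdsWithin (mem_nhdsWithin_of_mem_nhds (Iic_mem_nhds (by linarith)))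
  exact T.continuous_uncurry.comp_continuousOn (continuousOn_id.prodMk hprim)

/-- If `e^{s/2}‖f(s)‖ ≤ B`, the Duhamel integral has the same decay rate `1/2`. -/
theorem exp_mul_norm_duhamel_le {f : ℝ → X} {t B : ℝ} (ht : 0 ≤ t)
    (hB : ∀ s ∈ Ioc 0 t, Real.exp (s / 2) * ‖f s‖ ≤ B) :
    Real.exp (t / 2) * ‖T.duhamel f t‖ ≤ 2 * B * (1 - Real.exp (-(t / 2))) := by
  have h : ‖T.duhamel f t‖ ≤ ∫ s in (0 : ℝ)..t, B * Real.exp (-t) * Real.exp (s / 2) := by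
    refine T.norm_duhamel_le ht (Continuous.intervalIntegrable (by fun_prop) _ _) fun s hs => ?_
    calc Real.exp (-(t - s)) * ‖f s‖
        = (Real.exp (s / 2) * ‖f s‖) * (Real.exp (-t) * Real.exp (s / 2)) := by
          rw [show -(t - s) = s / 2 + -t + s / 2 by ring, Real.exp_add, Real.exp_add]
          ring
      _ ≤ B * (Real.exp (-t) * Real.exp (s / 2)) := by gcongr; exact hB s hs
      _ = _ := by ring
  have hi : ∫ s in (0 : ℝ)..t, B * Real.exp (-t) * Real.exp (s / 2) =
      B * Real.exp (-t) * (2 * (Real.exp (t / 2) - 1)) := by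
    rw [intervalIntegral.integral_const_mul, intervalIntegral.integral_comp_div _ two_ne_zero]
    simp
  rw [hi] at h
  calc Real.exp (t / 2) * ‖T.duhamel f t‖
      ≤ Real.exp (t / 2) * (B * Real.exp (-t) * (2 * (Real.exp (t / 2) - 1))) := by gcongr
    _ = 2 * B * (Real.exp (t / 2) * Real.exp (-t) * Real.exp (t / 2)
          - Real.exp (t / 2) * Real.exp (-t)) := by ring
    _ = _ := by
      rw [← Real.exp_add, ← Real.exp_add]
      ring_nf
      simp

end DampedGroup

theorem coe_l2wNorm {U : Type*} [NormedAddCommGroup U] [NormedSpace ℂ U] (ω : ℝ) (J : Set ℝ)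
    (u : ℝ → U) : (l2wNorm ω J u : ℝ) = (eLpNorm (expWeight ω u) 2 (volume.restrict J)).toReal :=
  rfl

theorem l2wNorm_mono {U : Type*} [NormedAddCommGroup U] [NormedSpace ℂ U] {ω : ℝ} {I J : Set ℝ}
    {u : ℝ → U} (hu : MemLp (expWeight ω u) 2 (volume.restrict J)) (hIJ : I ⊆ J) :
    l2wNorm ω I u ≤ l2wNorm ω J u :=
  ENNReal.toNNReal_mono hu.2.ne (eLpNorm_mono_measure _ (Measure.restrict_mono hIJ le_rfl))

theorem MeasureTheory.MemLp.intervalIntegrable_of_Ioi {U : Type*} [NormedAddCommGroup U]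
    {u : ℝ → U} (hu : MemLp u 2 (volume.restrict (Ioi 0))) (t : ℝ) (ht : 0 ≤ t) :
    IntervalIntegrable u volume 0 t := by
  rw [intervalIntegrable_iff_integrableOn_Ioc_of_le ht]
  exact (hu.mono_measure (Measure.restrict_mono Ioc_subset_Ioi_self le_rfl)).integrable
    (by norm_num)

/-- The Cauchy–Schwarz inequality against the kernel `e^{-(1-ω)(t-s)}`, whose `L²(0,t)`-norm is at
most one for `ω ≤ 1/2`. -/
theorem DampedGroup.exp_mul_norm_duhamel_le_l2wNorm {X : Type*} [NormedAddCommGroup X]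
    [NormedSpace ℂ X] (T : DampedGroup X) {ω t : ℝ} (hω : ω ≤ 1 / 2) (ht : 0 ≤ t) {u : ℝ → X}
    (hu : MemLp (expWeight ω u) 2 (volume.restrict (Ioi 0))) :
    Real.exp (ω * t) * ‖T.duhamel u t‖ ≤ l2wNorm ω (Ioo 0 t) u := by
  have hu' : MemLp (expWeight ω u) 2 (volume.restrict (Ioo 0 t)) :=
    hu.mono_measure (Measure.restrict_mono Ioo_subset_Ioi_self le_rfl)
  set k : ℝ → ℝ := fun s => Real.exp (-((1 - ω) * (t - s))) with hk
  have hkc : Continuous k := by fun_prop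
  have hkL : MemLp k 2 (volume.restrict (Ioo 0 t)) := by
    refine MemLp.of_bound hkc.aestronglyMeasurable 1 ?_
    filter_upwards [ae_restrict_mem measurableSet_Ioo] with s hs
    rw [Real.norm_of_nonneg (Real.exp_pos _).le, Real.exp_le_one_iff]
    have : 0 ≤ (1 - ω) * (t - s) := mul_nonneg (by linarith) (by linarith [hs.2])
    linarith
  have hint : IntervalIntegrable (fun s => k s * ‖expWeight ω u s‖) volume 0 t := by
    rw [intervalIntegrable_iff_integrableOn_Ioo_of_le ht]
    exact hu'.norm.integrable_mul hkL |>.congr (ae_of_all _ fun s => mul_comm _ _)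
  have h1 : ‖T.duhamel u t‖ ≤
      ∫ s in (0 : ℝ)..t, Real.exp (-(ω * t)) * (k s * ‖expWeight ω u s‖) := by
    refine T.norm_duhamel_le ht (hint.const_mul _) fun s _ => le_of_eq ?_
    rw [expWeight, norm_smul, Real.norm_of_nonneg (Real.exp_pos _).le, hk, ← mul_assoc,
      ← mul_assoc, ← Real.exp_add, ← Real.exp_add]
    ring_nf
  rw [intervalIntegral.integral_const_mul] at h1
  have h2 : Real.exp (ω * t) * ‖T.duhamel u t‖ ≤ ∫ s in (0 : ℝ)..t, k s * ‖expWeight ω u s‖ := by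
    calc _ ≤ Real.exp (ω * t) * (Real.exp (-(ω * t)) *
          ∫ s in (0 : ℝ)..t, k s * ‖expWeight ω u s‖) := by gcongr
      _ = _ := by rw [← mul_assoc, ← Real.exp_add]; simp
  refine h2.trans ?_
  rw [intervalIntegral.integral_of_le ht, integral_Ioc_eq_integral_Ioo]
  have hcs := integral_mul_le_Lp_mul_Lq_of_nonneg (μ := volume.restrict (Ioo 0 t))
    Real.HolderConjugate.two_two (f := k) (g := fun s => ‖expWeight ω u s‖)
    (ae_of_all _ fun s => (Real.exp_pos _).le) (ae_of_all _ fun s => norm_nonneg _)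
    (by simpa using hkL) (by simpa using hu'.norm)
  refine hcs.trans ?_
  have hk1 : ∫ s in Ioo 0 t, k s ^ (2 : ℝ) ≤ 1 := by
    calc ∫ s in Ioo 0 t, k s ^ (2 : ℝ) ≤ ∫ s in Ioo 0 t, Real.exp (s - t) := by
          have hc2 : Continuous fun s => k s ^ (2 : ℝ) := by
            simp only [Real.rpow_two]; fun_prop
          refine setIntegral_mono_on (hc2.integrableOn_Ioc.mono_set Ioo_subset_Ioc_self)
            ((by fun_prop : Continuous fun s => Real.exp (s - t)).integrableOn_Ioc.mono_set
              Ioo_subset_Ioc_self) measurableSet_Ioo fun s hs => ?_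
          rw [Real.rpow_two, hk, ← Real.exp_nat_mul, Real.exp_le_exp]
          push_cast
          nlinarith [hs.2]
      _ = 1 - Real.exp (-t) := by
          rw [← integral_Ioc_eq_integral_Ioo, ← intervalIntegral.integral_of_le ht,
            intervalIntegral.integral_comp_sub_right fun s => Real.exp s]
          simp
      _ ≤ 1 := by linarith [Real.exp_pos (-t)]
  have hn : (∫ s in Ioo 0 t, ‖expWeight ω u s‖ ^ (2 : ℝ)) ^ (1 / (2 : ℝ)) =
      l2wNorm ω (Ioo 0 t) u := by
    rw [coe_l2wNorm, hu'.eLpNorm_eq_integral_rpow_norm (by norm_num) (by norm_num),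
      ENNReal.toReal_ofReal (by positivity)]
    simp
  rw [hn]
  have : (∫ s in Ioo 0 t, k s ^ (2 : ℝ)) ^ (1 / (2 : ℝ)) ≤ 1 :=
    Real.rpow_le_one (integral_nonneg fun s => by positivity) hk1 (by norm_num)
  calc _ ≤ 1 * (l2wNorm ω (Ioo 0 t) u : ℝ) := by gcongr
    _ = _ := one_mul _


/-! ### Small mild solutions with a bilinear nonlinearity -/

theorem ContinuousOn.intervalIntegrable_of_Ici {E : Type*} [NormedAddCommGroup E] {f : ℝ → E}
    (hf : ContinuousOn f (Ici 0)) (t : ℝ) (ht : 0 ≤ t) :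
    IntervalIntegrable f volume 0 t := by
  refine (hf.mono ?_).intervalIntegrable
  rw [uIcc_of_le ht]
  exact Icc_subset_Ici_self

namespace DampedGroup

variable {X : Type*} [NormedAddCommGroup X] [NormedSpace ℂ X] (T : DampedGroup X)
  (N : X →L[ℂ] X →L[ℂ] X)

/-- `z` satisfies the variation of constants formula for `z' = A z + u + N(z, z)`. -/
def IsMild (z₀ : X) (u z : ℝ → X) : Prop :=
  ∀ t, 0 ≤ t → z t = T.op t z₀ + T.duhamel u t + T.duhamel (fun s => N (z s) (z s)) t

theorem norm_bilin_sub_le {K : ℝ} (hN : ∀ x y, ‖N x y‖ ≤ K * ‖x‖ * ‖y‖) (x y : X) :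
    ‖N x x - N y y‖ ≤ K * (‖x‖ + ‖y‖) * ‖x - y‖ := by
  have : N x x - N y y = N (x - y) x + N y (x - y) := by
    simp [map_sub]
  rw [this]
  refine (norm_add_le _ _).trans ((add_le_add (hN _ _) (hN _ _)).trans (le_of_eq ?_))
  ring

theorem _root_.ContinuousOn.bilin {z y : ℝ → X} {s : Set ℝ} (hz : ContinuousOn z s)
    (hy : ContinuousOn y s) : ContinuousOn (fun t => N (z t) (y t)) s :=
  (N.continuous.comp_continuousOn hz).clm_apply hy

/-- If `w` is bounded and continuous, the function `t ↦ e^{-t/2} w(t)` decays exponentially. -/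
def decaying (w : BoundedContinuousFunction ℝ≥0 X) (t : ℝ) : X :=
  Real.exp (-(t / 2)) • w t.toNNReal


theorem continuous_decaying (w : BoundedContinuousFunction ℝ≥0 X) : Continuous (decaying w) := by
  unfold decaying
  have := w.continuous.comp continuous_real_toNNReal
  simp only [Function.comp_def] at this
  fun_prop

theorem exp_mul_norm_decaying_le (w : BoundedContinuousFunction ℝ≥0 X) (t : ℝ) :
    Real.exp (t / 2) * ‖decaying w t‖ ≤ ‖w‖ := by
  rw [decaying, norm_smul, Real.norm_of_nonneg (Real.exp_pos _).le, ← mul_assoc, ← Real.exp_add]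
  simpa using w.norm_coe_le_norm _

theorem norm_decaying_le (w : BoundedContinuousFunction ℝ≥0 X) {t : ℝ} (ht : 0 ≤ t) :
    ‖decaying w t‖ ≤ ‖w‖ := by
  refine le_trans ?_ (exp_mul_norm_decaying_le w t)
  exact le_mul_of_one_le_left (norm_nonneg _) (Real.one_le_exp (by positivity))

theorem exp_mul_norm_decaying_sub_le (v w : BoundedContinuousFunction ℝ≥0 X) (t : ℝ) :
    Real.exp (t / 2) * ‖decaying v t - decaying w t‖ ≤ ‖v - w‖ := by
  have : decaying v t - decaying w t = decaying (v - w) t := by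
    simp [decaying, smul_sub]
  rw [this]
  exact exp_mul_norm_decaying_le _ _

variable {N} in
/-- Small data have a global mild solution, found as a fixed point of the variation of constants
formula among the functions with `e^{t/2}‖z(t)‖ ≤ r`. As the group decays faster than `e^{-t/2}`,
the contraction works on all of `[0,∞)` at once. With `K r = 1/8` the quadratic term has weighted norm
at most `2 K r² = r / 4` on the ball of radius `r`, and Lipschitz constant `4 K r = 1/2`. -/
theorem exists_isMild [CompleteSpace X] {K r : ℝ} (hK : 0 < K) (hr : r = 1 / (8 * K))
    (hN : ∀ x y, ‖N x y‖ ≤ K * ‖x‖ * ‖y‖) {z₀ : X} {u : ℝ → X} (hu : MemL2w (1 / 2) u)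
    (hsmall : ‖z₀‖ + l2wNorm (1 / 2) (Ioi 0) u ≤ r / 2) :
    ∃ z : ℝ → X, Continuous z ∧ T.IsMild N z₀ u z ∧ ∀ t, 0 ≤ t → ‖z t‖ ≤ r := by
  have hr0 : 0 < r := by rw [hr]; positivity
  have hKr : K * r = 1 / 8 := by rw [hr]; field_simp
  let E := BoundedContinuousFunction ℝ≥0 X
  -- the weighted right-hand side of the variation of constants formula
  let G : E → ℝ≥0 → X := fun w t => Real.exp ((t : ℝ) / 2) • (T.op t z₀ + T.duhamel u t +
    T.duhamel (fun s => N (decaying w s) (decaying w s)) t)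
  have hNc : ∀ w : E, Continuous fun s => N (decaying w s) (decaying w s) := fun w =>
    (N.continuous.comp (continuous_decaying w)).clm_apply (continuous_decaying w)
  have hNint : ∀ (w : E) (t : ℝ), 0 ≤ t →
      IntervalIntegrable (fun s => N (decaying w s) (decaying w s)) volume 0 t := fun w t _ =>
    (hNc w).intervalIntegrable _ _
  have hGc : ∀ w, Continuous (G w) := by
    intro w
    have hon : ContinuousOn (fun t : ℝ => Real.exp (t / 2) • (T.op t z₀ + T.duhamel u t +
        T.duhamel (fun s => N (decaying w s) (decaying w s)) t)) (Ici 0) := by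
      have hexp : Continuous fun t : ℝ => Real.exp (t / 2) := by fun_prop
      refine hexp.continuousOn.smul ?_
      exact ((T.continuous_orbit z₀).continuousOn.add
        (T.continuousOn_duhamel hu.1.intervalIntegrable_of_Ioi)).add
          (T.continuousOn_duhamel (hNint w))
    exact hon.comp_continuous NNReal.continuous_coe fun t => t.2
  have hNb : ∀ (w : E) (s : ℝ), 0 ≤ s →
      Real.exp (s / 2) * ‖N (decaying w s) (decaying w s)‖ ≤ K * ‖w‖ * ‖w‖ := by
    intro w s hs
    calc _ ≤ Real.exp (s / 2) * (K * ‖decaying w s‖ * ‖decaying w s‖) := by gcongr; exact hN _ _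
      _ = K * ‖decaying w s‖ * (Real.exp (s / 2) * ‖decaying w s‖) := by ring
      _ ≤ K * ‖w‖ * ‖w‖ := by
        gcongr
        · exact norm_decaying_le w hs
        · exact exp_mul_norm_decaying_le w s
  have hGb : ∀ w t, ‖G w t‖ ≤ r / 2 + 2 * (K * ‖w‖ * ‖w‖) := by
    intro w t
    have ht : (0 : ℝ) ≤ t := t.2
    have h1 : Real.exp ((t : ℝ) / 2) * ‖T.op t z₀‖ ≤ ‖z₀‖ := by
      calc _ ≤ Real.exp ((t : ℝ) / 2) * (Real.exp (-t) * ‖z₀‖) := by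
            gcongr; exact T.norm_op_apply_le _ _
        _ = Real.exp (-((t : ℝ) / 2)) * ‖z₀‖ := by
            rw [← mul_assoc, ← Real.exp_add]; ring_nf
        _ ≤ 1 * ‖z₀‖ := by gcongr; exact Real.exp_le_one_iff.2 (by linarith)
        _ = _ := one_mul _
    have h2 : Real.exp ((t : ℝ) / 2) * ‖T.duhamel u t‖ ≤ l2wNorm (1 / 2) (Ioi 0) u := by
      have := T.exp_mul_norm_duhamel_le_l2wNorm le_rfl ht hu.2
      rw [one_div_mul_eq_div] at this
      exact this.trans (NNReal.coe_le_coe.2 (l2wNorm_mono hu.2 Ioo_subset_Ioi_self))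
    have h3 : Real.exp ((t : ℝ) / 2) *
        ‖T.duhamel (fun s => N (decaying w s) (decaying w s)) t‖ ≤ 2 * (K * ‖w‖ * ‖w‖) := by
      refine (T.exp_mul_norm_duhamel_le ht fun s hs => hNb w s hs.1.le).trans ?_
      refine mul_le_of_le_one_right (by positivity) ?_
      linarith [Real.exp_pos (-((t : ℝ) / 2))]
    rw [norm_smul, Real.norm_of_nonneg (Real.exp_pos _).le]
    calc _ ≤ Real.exp ((t : ℝ) / 2) * (‖T.op t z₀‖ + ‖T.duhamel u t‖ +
          ‖T.duhamel (fun s => N (decaying w s) (decaying w s)) t‖) := by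
            gcongr; exact norm_add₃_le
      _ ≤ _ := by rw [mul_add, mul_add]; linarith
  let Γ : E → E := fun w => BoundedContinuousFunction.ofNormedAddCommGroup (G w) (hGc w) _ (hGb w)
  have hmaps : MapsTo Γ (Metric.closedBall 0 r) (Metric.closedBall 0 r) := by
    intro w hw
    rw [mem_closedBall_zero_iff] at hw ⊢
    refine (BoundedContinuousFunction.norm_le hr0.le).2 fun t => (hGb w t).trans ?_
    have : K * ‖w‖ * ‖w‖ ≤ K * r * r := by gcongr
    rw [hKr] at this
    linarith
  have hcontr : ContractingWith (1 / 2) (hmaps.restrict Γ _ _) := by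
    refine ⟨by rw [← NNReal.coe_lt_coe]; norm_num, LipschitzWith.of_dist_le_mul ?_⟩
    rintro ⟨v, hv⟩ ⟨w, hw⟩
    rw [mem_closedBall_zero_iff] at hv hw
    change dist (Γ v) (Γ w) ≤ ((1 / 2 : ℝ≥0) : ℝ) * dist v w
    refine (BoundedContinuousFunction.dist_le (by positivity)).2 fun t => ?_
    have ht : (0 : ℝ) ≤ t := t.2
    have hdiff : G v t - G w t = Real.exp ((t : ℝ) / 2) • T.duhamel (fun s =>
        N (decaying v s) (decaying v s) - N (decaying w s) (decaying w s)) t := by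
      rw [← T.duhamel_sub (hNint v t ht) (hNint w t ht), ← smul_sub]
      congr 1
      abel
    change dist (G v t) (G w t) ≤ _
    rw [dist_eq_norm, hdiff, norm_smul, Real.norm_of_nonneg (Real.exp_pos _).le, dist_eq_norm]
    refine (T.exp_mul_norm_duhamel_le (B := K * (r + r) * ‖v - w‖) ht fun s hs => ?_).trans ?_
    · calc _ ≤ Real.exp (s / 2) * (K * (‖decaying v s‖ + ‖decaying w s‖) *
            ‖decaying v s - decaying w s‖) := by gcongr; exact norm_bilin_sub_le N hN _ _
        _ = K * (‖decaying v s‖ + ‖decaying w s‖) *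
            (Real.exp (s / 2) * ‖decaying v s - decaying w s‖) := by ring
        _ ≤ _ := by
          gcongr
          · exact (norm_decaying_le v hs.1.le).trans hv
          · exact (norm_decaying_le w hs.1.le).trans hw
          · exact exp_mul_norm_decaying_sub_le v w s
    · have h4 : K * (r + r) = 1 / 4 := by linarith
      rw [h4]
      push_cast
      have h5 : 0 ≤ ‖v - w‖ * Real.exp (-((t : ℝ) / 2)) := by positivity
      nlinarith
  obtain ⟨w, hw, hfix, -⟩ := hcontr.exists_fixedPoint' Metric.isClosed_closedBall.isComplete hmaps
    (Metric.mem_closedBall_self hr0.le) (edist_ne_top _ _)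
  rw [mem_closedBall_zero_iff] at hw
  refine ⟨decaying w, continuous_decaying w, fun t ht => ?_, fun t ht =>
    (norm_decaying_le w ht).trans hw⟩
  have hwt : w t.toNNReal = G w t.toNNReal := by
    conv_lhs => rw [← hfix.eq]
    rfl
  have h6 : decaying w t = Real.exp (-(t / 2)) • G w t.toNNReal := by rw [decaying, hwt]
  rw [h6]
  simp only [G, Real.coe_toNNReal t ht]
  rw [smul_smul, ← Real.exp_add]
  simp

variable {N} in
/-- The decay estimate for a small mild solution, with constant one in front of `‖z₀‖`. It follows
from the variation of constants formula at a maximum point of `e^{s/2}‖z(s)‖` on `[0,t]`. -/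
theorem IsMild.norm_le {K r : ℝ} (hK : 0 < K) (hr : r = 1 / (8 * K))
    (hN : ∀ x y, ‖N x y‖ ≤ K * ‖x‖ * ‖y‖) {z₀ : X} {u z : ℝ → X} (hu : MemL2w (1 / 2) u)
    (hz : T.IsMild N z₀ u z) (hzc : Continuous z) (hzr : ∀ t, 0 ≤ t → ‖z t‖ ≤ r)
    {t : ℝ} (ht : 0 ≤ t) :
    Real.exp (t / 2) * ‖z t‖ ≤ ‖z₀‖ + 2 * l2wNorm (1 / 2) (Ioo 0 t) u := by
  have hKr : K * r = 1 / 8 := by rw [hr]; field_simp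
  set U : ℝ := (l2wNorm (1 / 2) (Ioo 0 t) u : ℝ) with hU
  have hU0 : 0 ≤ U := NNReal.coe_nonneg _
  obtain ⟨τ, hτ, hmax⟩ := isCompact_Icc.exists_isMaxOn (nonempty_Icc.2 ht)
    (f := fun s => Real.exp (s / 2) * ‖z s‖) (by fun_prop)
  set M : ℝ := Real.exp (τ / 2) * ‖z τ‖ with hM
  have hmax' : ∀ s ∈ Icc 0 t, Real.exp (s / 2) * ‖z s‖ ≤ M := fun s hs => hmax hs
  refine (hmax' t ⟨ht, le_rfl⟩).trans ?_
  set θ : ℝ := Real.exp (-(τ / 2)) with hθ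
  have hθ0 : 0 < θ := Real.exp_pos _
  have hθ1 : θ ≤ 1 := Real.exp_le_one_iff.2 (by linarith [hτ.1])
  have h1 : Real.exp (τ / 2) * ‖T.op τ z₀‖ ≤ θ * ‖z₀‖ := by
    calc _ ≤ Real.exp (τ / 2) * (Real.exp (-τ) * ‖z₀‖) := by
          gcongr; exact T.norm_op_apply_le _ _
      _ = θ * ‖z₀‖ := by
          rw [← mul_assoc, ← Real.exp_add, hθ]; ring_nf
  have h2 : Real.exp (τ / 2) * ‖T.duhamel u τ‖ ≤ U := by
    have := T.exp_mul_norm_duhamel_le_l2wNorm le_rfl hτ.1 hu.2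
    rw [one_div_mul_eq_div] at this
    refine this.trans (NNReal.coe_le_coe.2 (l2wNorm_mono ?_ (Ioo_subset_Ioo_right hτ.2)))
    exact hu.2.mono_measure (Measure.restrict_mono Ioo_subset_Ioi_self le_rfl)
  have h3 : Real.exp (τ / 2) * ‖T.duhamel (fun s => N (z s) (z s)) τ‖ ≤
      2 * (1 / 8 * M) * (1 - θ) := by
    refine T.exp_mul_norm_duhamel_le hτ.1 fun s hs => ?_
    have hs0 : 0 ≤ s := hs.1.le
    calc _ ≤ Real.exp (s / 2) * (K * ‖z s‖ * ‖z s‖) := by gcongr; exact hN _ _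
      _ = K * ‖z s‖ * (Real.exp (s / 2) * ‖z s‖) := by ring
      _ ≤ K * r * M := by
        gcongr
        · exact hzr s hs0
        · exact hmax' s ⟨hs0, hs.2.trans hτ.2⟩
      _ = _ := by rw [hKr]
  have h4 : M ≤ θ * ‖z₀‖ + U + 2 * (1 / 8 * M) * (1 - θ) := by
    have : M ≤ Real.exp (τ / 2) * (‖T.op τ z₀‖ + ‖T.duhamel u τ‖ +
        ‖T.duhamel (fun s => N (z s) (z s)) τ‖) := by
      rw [hM, hz τ hτ.1]
      gcongr
      exact norm_add₃_le
    rw [mul_add, mul_add] at this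
    linarith
  -- `h4` reads `M (3/4 + θ/4) ≤ θ ‖z₀‖ + U`, which is at most `(‖z₀‖ + 2U) (3/4 + θ/4)` as `θ ≤ 1`
  by_contra! hlt
  have h5 : (‖z₀‖ + 2 * U) * (3 / 4 + θ / 4) < M * (3 / 4 + θ / 4) := by gcongr
  nlinarith [mul_nonneg (norm_nonneg z₀) (sub_nonneg.2 hθ1), mul_nonneg hU0 hθ0.le]

/-- A continuous nonnegative function dominated by a multiple of its own integral vanishes. -/
theorem _root_.eq_zero_of_le_mul_integral {d : ℝ → ℝ} {L t : ℝ} (hL : 0 ≤ L) (ht : 0 ≤ t)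
    (hd : ContinuousOn d (Icc 0 t)) (hd0 : ∀ s ∈ Icc 0 t, 0 ≤ d s)
    (h : ∀ s ∈ Icc 0 t, d s ≤ L * ∫ σ in (0 : ℝ)..s, d σ) : d t = 0 := by
  -- a maximum `M` of `e^{-ls} d(s)` with `l > L` satisfies `M ≤ (L / l) M`
  set l : ℝ := L + 1 with hl
  have hl0 : 0 < l := by positivity
  obtain ⟨τ, hτ, hmax⟩ := isCompact_Icc.exists_isMaxOn (nonempty_Icc.2 ht)
    (f := fun s => Real.exp (-(l * s)) * d s) (by fun_prop)
  set M : ℝ := Real.exp (-(l * τ)) * d τ with hM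
  have hM0 : 0 ≤ M := mul_nonneg (Real.exp_pos _).le (hd0 τ hτ)
  have hle : ∀ s ∈ Icc 0 t, d s ≤ M * Real.exp (l * s) := by
    intro s hs
    have h1 : Real.exp (-(l * s)) * d s ≤ M := hmax hs
    calc d s = (Real.exp (-(l * s)) * d s) * Real.exp (l * s) := by
          rw [mul_right_comm, ← Real.exp_add]; simp
      _ ≤ _ := by gcongr
  have h2 : ∫ σ in (0 : ℝ)..τ, d σ ≤ ∫ σ in (0 : ℝ)..τ, M * Real.exp (l * σ) := by
    refine intervalIntegral.integral_mono_on hτ.1 ?_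
      (Continuous.intervalIntegrable (by fun_prop) _ _)
      fun s hs => hle s ⟨hs.1, hs.2.trans hτ.2⟩
    refine (hd.mono ?_).intervalIntegrable
    rw [uIcc_of_le hτ.1]
    exact Icc_subset_Icc_right hτ.2
  have h3 : ∫ σ in (0 : ℝ)..τ, M * Real.exp (l * σ) = M * (l⁻¹ * (Real.exp (l * τ) - 1)) := by
    rw [intervalIntegral.integral_const_mul,
      intervalIntegral.integral_comp_mul_left (fun x => Real.exp x) hl0.ne']
    simp
  have h4 : l * M ≤ L * M := by
    have h5 : d τ ≤ L * (M * (l⁻¹ * (Real.exp (l * τ) - 1))) :=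
      (h τ hτ).trans (by rw [← h3]; gcongr)
    have h6 : d τ ≤ L * M * l⁻¹ * Real.exp (l * τ) := by
      have : 0 ≤ L * M * l⁻¹ := by positivity
      nlinarith
    calc l * M ≤ l * (Real.exp (-(l * τ)) * (L * M * l⁻¹ * Real.exp (l * τ))) := by
          rw [hM]; gcongr
      _ = L * M * (l * l⁻¹) * (Real.exp (-(l * τ)) * Real.exp (l * τ)) := by ring
      _ = L * M := by rw [← Real.exp_add, mul_inv_cancel₀ hl0.ne']; simp
  have hM1 : M = 0 := by nlinarith
  refine le_antisymm ?_ (hd0 t ⟨ht, le_rfl⟩)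
  simpa [hM1] using hle t ⟨ht, le_rfl⟩

variable {N} in
theorem IsMild.eqOn {K : ℝ} (hK : 0 ≤ K) (hN : ∀ x y, ‖N x y‖ ≤ K * ‖x‖ * ‖y‖) {z₀ : X}
    {u z z' : ℝ → X} (hz : T.IsMild N z₀ u z) (hzc : ContinuousOn z (Ici 0))
    (hz' : T.IsMild N z₀ u z') (hzc' : ContinuousOn z' (Ici 0)) : EqOn z' z (Ici 0) := by
  intro t ht
  have ht0 : (0 : ℝ) ≤ t := ht
  have hsub : Icc 0 t ⊆ Ici (0 : ℝ) := Icc_subset_Ici_self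
  obtain ⟨R, hR⟩ := isCompact_Icc.exists_bound_of_continuousOn (hzc.mono hsub)
  obtain ⟨R', hR'⟩ := isCompact_Icc.exists_bound_of_continuousOn (hzc'.mono hsub)
  have hR0 : 0 ≤ R := (norm_nonneg _).trans (hR 0 ⟨le_rfl, ht0⟩)
  have hR0' : 0 ≤ R' := (norm_nonneg _).trans (hR' 0 ⟨le_rfl, ht0⟩)
  have hdc : ContinuousOn (fun s => ‖z' s - z s‖) (Ici 0) := (hzc'.sub hzc).norm
  have := eq_zero_of_le_mul_integral (d := fun s => ‖z' s - z s‖) (L := K * (R' + R))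
    (by positivity) ht0 (hdc.mono hsub) (fun _ _ => norm_nonneg _) ?_
  · exact sub_eq_zero.1 (norm_eq_zero.1 this)
  intro s hs
  have hd : z' s - z s = T.duhamel (fun σ => N (z' σ) (z' σ) - N (z σ) (z σ)) s := by
    rw [← T.duhamel_sub ((hzc'.bilin N hzc').intervalIntegrable_of_Ici s hs.1)
      ((hzc.bilin N hzc).intervalIntegrable_of_Ici s hs.1), hz' s hs.1, hz s hs.1]
    abel
  rw [← intervalIntegral.integral_const_mul]
  rw [hd]
  refine T.norm_duhamel_le hs.1 ?_ fun σ hσ => ?_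
  · refine ((hdc.mono ?_).intervalIntegrable).const_mul _
    rw [uIcc_of_le hs.1]
    exact Icc_subset_Ici_self
  · have hσ' : σ ∈ Icc 0 t := ⟨hσ.1.le, hσ.2.trans hs.2⟩
    calc _ ≤ 1 * ‖N (z' σ) (z' σ) - N (z σ) (z σ)‖ := by
          gcongr; exact Real.exp_le_one_iff.2 (by linarith [hσ.2])
      _ ≤ K * (‖z' σ‖ + ‖z σ‖) * ‖z' σ - z σ‖ := by
          rw [one_mul]; exact norm_bilin_sub_le N hN _ _
      _ ≤ _ := by
          gcongr
          · exact hR' σ hσ'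
          · exact hR σ hσ'

end DampedGroup


/-! ### Primitives and products in `H¹₀(0,1)` -/

/-- Lebesgue measure on `(0,1)`. -/
abbrev unitVol : Measure ℝ := volume.restrict (Ioo (0 : ℝ) 1)

instance : IsProbabilityMeasure unitVol := ⟨by simp⟩

theorem memLp_unitVol_of_continuous {f : ℝ → ℂ} (hf : Continuous f) (p : ℝ≥0∞) :
    MemLp f p unitVol := by
  obtain ⟨C, hC⟩ := (isCompact_Icc (a := (0 : ℝ)) (b := 1)).exists_bound_of_continuousOn
    hf.continuousOn
  refine MemLp.of_bound hf.aestronglyMeasurable C ?_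
  filter_upwards [ae_restrict_mem measurableSet_Ioo] with x hx using hC x (Ioo_subset_Icc_self hx)

/-- A continuous function as an element of `L²(0,1)`. -/
def contL2 (f : ℝ → ℂ) (hf : Continuous f) : L2I :=
  (memLp_unitVol_of_continuous hf 2).toLp f

theorem coeFn_contL2 (f : ℝ → ℂ) (hf : Continuous f) : contL2 f hf =ᵐ[unitVol] f :=
  MemLp.coeFn_toLp _

theorem L2I.integrable (g : L2I) : Integrable g unitVol :=
  (Lp.memLp g).integrable (by norm_num)

theorem integral_unitVol (f : ℝ → ℂ) : ∫ x, f x ∂unitVol = ∫ x in (0 : ℝ)..1, f x := by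
  rw [intervalIntegral.integral_of_le zero_le_one, integral_Ioc_eq_integral_Ioo]

/-- The primitive `x ↦ ∫₀ˣ g`. -/
def prim (g : L2I) (x : ℝ) : ℂ := ∫ s in (0 : ℝ)..x, g s ∂unitVol

theorem continuous_prim (g : L2I) : Continuous (prim g) :=
  intervalIntegral.continuous_primitive (fun _ _ => (L2I.integrable g).intervalIntegrable) 0

theorem norm_prim_le (g : L2I) (x : ℝ) : ‖prim g x‖ ≤ ‖g‖ := by
  calc ‖prim g x‖ ≤ ∫ s in uIoc 0 x, ‖g s‖ ∂unitVol :=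
        intervalIntegral.norm_integral_le_integral_norm_uIoc
    _ ≤ ∫ s, ‖g s‖ ∂unitVol :=
        setIntegral_le_integral (L2I.integrable g).norm (ae_of_all _ fun _ => norm_nonneg _)
    _ = (eLpNorm g 1 unitVol).toReal := by
        rw [eLpNorm_one_eq_lintegral_enorm, integral_norm_eq_lintegral_enorm
          (L2I.integrable g).aestronglyMeasurable]
    _ ≤ ‖g‖ := by
        rw [Lp.norm_def]
        exact ENNReal.toReal_mono (Lp.eLpNorm_ne_top g)
          (eLpNorm_le_eLpNorm_of_exponent_le (by norm_num) (Lp.aestronglyMeasurable g))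

theorem prim_congr {g : L2I} {f : ℝ → ℂ} (h : g =ᵐ[unitVol] f) (x : ℝ) :
    prim g x = ∫ s in (0 : ℝ)..x, f s ∂unitVol :=
  intervalIntegral.integral_congr_ae (h.mono fun _ hs _ => hs)

theorem prim_add (f g : L2I) (x : ℝ) : prim (f + g) x = prim f x + prim g x := by
  rw [prim_congr (Lp.coeFn_add f g)]
  exact intervalIntegral.integral_add (L2I.integrable f).intervalIntegrable
    (L2I.integrable g).intervalIntegrable

theorem prim_smul (c : ℂ) (g : L2I) (x : ℝ) : prim (c • g) x = c * prim g x := by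
  rw [prim_congr (Lp.coeFn_smul c g)]
  exact intervalIntegral.integral_const_mul c _

/-- The primitive as a bounded operator `L²(0,1) → L^∞(0,1)`. -/
def primL : L2I →L[ℂ] Lp ℂ ∞ unitVol :=
  LinearMap.mkContinuous
    { toFun := fun g => (memLp_unitVol_of_continuous (continuous_prim g) ∞).toLp (prim g)
      map_add' := fun f g => by
        rw [← MemLp.toLp_add]
        exact MemLp.toLp_congr _ _ (ae_of_all _ (prim_add f g))
      map_smul' := fun c g => by
        rw [← MemLp.toLp_const_smul]
        exact MemLp.toLp_congr _ _ (ae_of_all _ (prim_smul c g)) }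
    1 fun g => by
      rw [one_mul]
      have hle : ‖(memLp_unitVol_of_continuous (continuous_prim g) ∞).toLp (prim g)‖ ≤
          (measureUnivNNReal unitVol : ℝ) ^ (∞ : ℝ≥0∞).toReal⁻¹ * ‖g‖ := by
        refine Lp.norm_le_of_ae_bound (norm_nonneg g) ?_
        filter_upwards [(memLp_unitVol_of_continuous (continuous_prim g) ∞).coeFn_toLp] with x hx
        rw [hx]
        exact norm_prim_le g x
      simpa using hle

/-- Multiplication by the primitive of `g`, as a bounded bilinear map `(g, f) ↦ (∫₀ˣ g) f`. -/
def mulPrim : L2I →L[ℂ] L2I →L[ℂ] L2I :=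
  ((ContinuousLinearMap.mul ℂ ℂ).holderL unitVol ∞ 2 2).comp primL

theorem coeFn_mulPrim (g f : L2I) : mulPrim g f =ᵐ[unitVol] fun x => prim g x * f x := by
  filter_upwards [(ContinuousLinearMap.mul ℂ ℂ).coeFn_holder (r := 2) (primL g) f,
    (memLp_unitVol_of_continuous (continuous_prim g) ∞).coeFn_toLp] with x hx hy
  have : primL g x = prim g x := hy
  rw [← this]
  exact hx

theorem norm_mulPrim_le (g f : L2I) : ‖mulPrim g f‖ ≤ ‖g‖ * ‖f‖ := by
  refine Lp.norm_le_mul_norm_of_ae_le_mul ?_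
  filter_upwards [coeFn_mulPrim g f] with x hx
  rw [hx, norm_mul]
  gcongr
  exact norm_prim_le g x

/-- The bilinear pairing `∫₀¹ f g` on `L²(0,1)`. -/
def pairL2 : L2I →L[ℂ] L2I →L[ℂ] ℂ := (ContinuousLinearMap.mul ℂ ℂ).lpPairing unitVol 2 2

theorem pairL2_apply (f g : L2I) : pairL2 f g = ∫ x, f x * g x ∂unitVol :=
  (ContinuousLinearMap.mul ℂ ℂ).lpPairing_eq_integral f g

theorem IsTestFunction.apply_zero {φ : ℝ → ℂ} (hφ : IsTestFunction φ) : φ 0 = 0 := by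
  by_contra h
  simpa using hφ.support (subset_tsupport φ (Function.mem_support.2 h))

theorem IsTestFunction.apply_one {φ : ℝ → ℂ} (hφ : IsTestFunction φ) : φ 1 = 0 := by
  by_contra h
  simpa using hφ.support (subset_tsupport φ (Function.mem_support.2 h))

theorem IsTestFunction.differentiable {φ : ℝ → ℂ} (hφ : IsTestFunction φ) : Differentiable ℝ φ :=
  hφ.smooth.differentiable (by simp)

theorem IsTestFunction.continuous_deriv {φ : ℝ → ℂ} (hφ : IsTestFunction φ) :
    Continuous (deriv φ) :=
  hφ.smooth.continuous_deriv (by simp)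

theorem IsTestFunction.prim_eq {φ : ℝ → ℂ} (hφ : IsTestFunction φ) {g : L2I}
    (hg : g =ᵐ[unitVol] deriv φ) : prim g =ᵐ[unitVol] φ := by
  filter_upwards [ae_restrict_mem measurableSet_Ioo] with x hx
  have hsub : Ioc 0 x ⊆ Ioo 0 1 := fun s hs => ⟨hs.1, hs.2.trans_lt hx.2⟩
  rw [prim_congr hg, intervalIntegral.integral_of_le hx.1.le, Measure.restrict_restrict
    measurableSet_Ioc, inter_eq_left.2 hsub,
    ← intervalIntegral.integral_of_le hx.1.le, intervalIntegral.integral_deriv_eq_sub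
    (fun s _ => hφ.differentiable s) (hφ.continuous_deriv.intervalIntegrable _ _), hφ.apply_zero,
    sub_zero]

theorem IsTestFunction.mul {φ ψ : ℝ → ℂ} (hφ : IsTestFunction φ) (hψ : IsTestFunction ψ) :
    IsTestFunction fun x => φ x * ψ x :=
  ⟨hφ.smooth.mul hψ.smooth, hφ.compact.mul_right, (tsupport_mul_subset_left).trans hφ.support⟩

/-- The product rule on the level of pairs `(z, z')`. -/
def mulPair (p q : L2I × L2I) : L2I × L2I :=
  (mulPrim p.2 q.1, mulPrim p.2 q.2 + mulPrim q.2 p.2)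

theorem mulPair_mem {p q : L2I × L2I} (hp : p ∈ testPairs.topologicalClosure)
    (hq : q ∈ testPairs.topologicalClosure) : mulPair p q ∈ testPairs.topologicalClosure := by
  have hc : Continuous (Function.uncurry mulPair) := by
    unfold Function.uncurry mulPair
    have h2 : ∀ f g : (L2I × L2I) × (L2I × L2I) → L2I, Continuous f → Continuous g →
        Continuous fun r => mulPrim (f r) (g r) := fun f g hf hg =>
      (mulPrim.continuous.comp hf).clm_apply hg
    exact (h2 _ _ (by fun_prop) (by fun_prop)).prodMk
      ((h2 _ _ (by fun_prop) (by fun_prop)).add (h2 _ _ (by fun_prop) (by fun_prop)))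
  refine map_mem_closure₂ hc hp hq ?_
  rintro p ⟨φ, hφ, h1, h2⟩ q ⟨ψ, hψ, k1, k2⟩
  refine ⟨_, hφ.mul hψ, ?_, ?_⟩
  · filter_upwards [coeFn_mulPrim p.2 q.1, hφ.prim_eq h2, k1] with x hx h k
    rw [mulPair, hx, h, k]
  · filter_upwards [Lp.coeFn_add (mulPrim p.2 q.2) (mulPrim q.2 p.2), coeFn_mulPrim p.2 q.2,
      coeFn_mulPrim q.2 p.2, hφ.prim_eq h2, hψ.prim_eq k2, h2, k2] with x hx e1 e2 h k h' k'
    rw [mulPair, hx, Pi.add_apply, e1, e2, h, k, h', k',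
      deriv_fun_mul (hφ.differentiable x) (hψ.differentiable x)]
    ring

namespace H01

theorem ext_dx {z y : H01} (h : dx z = dx y) : z = y := dx_injective h

/-- An element of `H¹₀(0,1)` is the primitive of its weak derivative. -/
theorem fn_ae_eq_prim (z : H01) : fn z =ᵐ[unitVol] prim (dx z) := by
  have hone : ∀ g : L2I, mulPrim g (contL2 1 continuous_one) =ᵐ[unitVol] prim g := fun g => by
    filter_upwards [coeFn_mulPrim g (contL2 1 continuous_one), coeFn_contL2 1 continuous_one]
      with x h k
    rw [h, k, Pi.one_apply, mul_one]
  have hcl : IsClosed {p : L2I × L2I | p.1 = mulPrim p.2 (contL2 1 continuous_one)} :=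
    isClosed_eq (by fun_prop) ((mulPrim.continuous.comp continuous_snd).clm_apply continuous_const)
  have h : fn z = mulPrim (dx z) (contL2 1 continuous_one) := by
    refine closure_minimal (fun p hp => ?_) hcl z.2
    obtain ⟨φ, hφ, h1, h2⟩ := hp
    refine Lp.ext ?_
    filter_upwards [hone p.2, h1, hφ.prim_eq h2] with x a b c
    rw [a, b, c]
  rw [h]
  exact hone _

/-- Integration by parts of `z ∈ H¹₀(0,1)` against a `C¹` function; the boundary terms vanish. -/
theorem pairL2_dx_eq_neg (z : H01) {g g' : ℝ → ℂ} (hg : ∀ x, HasDerivAt g (g' x) x)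
    (hgc : Continuous g) (hgc' : Continuous g') :
    pairL2 (dx z) (contL2 g hgc) = -pairL2 (fn z) (contL2 g' hgc') := by
  have hcl : IsClosed {p : L2I × L2I |
      pairL2 p.2 (contL2 g hgc) = -pairL2 p.1 (contL2 g' hgc')} :=
    isClosed_eq ((pairL2.continuous.comp continuous_snd).clm_apply continuous_const)
      ((pairL2.continuous.comp continuous_fst).clm_apply continuous_const).neg
  refine closure_minimal (fun p hp => ?_) hcl z.2
  obtain ⟨φ, hφ, h1, h2⟩ := hp
  have e1 : pairL2 p.2 (contL2 g hgc) = ∫ x in (0 : ℝ)..1, deriv φ x * g x := by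
    rw [pairL2_apply, ← integral_unitVol]
    refine integral_congr_ae ?_
    filter_upwards [h2, coeFn_contL2 g hgc] with x a b
    rw [a, b]
  have e2 : pairL2 p.1 (contL2 g' hgc') = ∫ x in (0 : ℝ)..1, φ x * g' x := by
    rw [pairL2_apply, ← integral_unitVol]
    refine integral_congr_ae ?_
    filter_upwards [h1, coeFn_contL2 g' hgc'] with x a b
    rw [a, b]
  change pairL2 p.2 (contL2 g hgc) = -pairL2 p.1 (contL2 g' hgc')
  rw [e1, e2, intervalIntegral.integral_mul_deriv_eq_deriv_mul
    (fun x _ => (hφ.differentiable x).hasDerivAt) (fun x _ => hg x)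
    (hφ.continuous_deriv.intervalIntegrable _ _) (hgc'.intervalIntegrable _ _),
    hφ.apply_zero, hφ.apply_one]
  simp

/-- The pointwise product on `H¹₀(0,1)`. -/
def mul : H01 →L[ℂ] H01 →L[ℂ] H01 :=
  LinearMap.mkContinuous₂
    (LinearMap.mk₂ ℂ (fun z y : H01 =>
        ((⟨mulPair z.1 y.1, mulPair_mem z.2 y.2⟩ : ↥testPairs.topologicalClosure) : H01))
      (fun z z' y => ext_dx <| by
        change mulPrim (dx (z + z')) (dx y) + mulPrim (dx y) (dx (z + z')) =
          mulPrim (dx z) (dx y) + mulPrim (dx y) (dx z) +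
            (mulPrim (dx z') (dx y) + mulPrim (dx y) (dx z'))
        simp only [map_add, _root_.add_apply]
        abel)
      (fun c z y => ext_dx <| by
        change mulPrim (dx (c • z)) (dx y) + mulPrim (dx y) (dx (c • z)) =
          c • (mulPrim (dx z) (dx y) + mulPrim (dx y) (dx z))
        simp only [map_smul, _root_.smul_apply, smul_add])
      (fun z y y' => ext_dx <| by
        change mulPrim (dx z) (dx (y + y')) + mulPrim (dx (y + y')) (dx z) =
          mulPrim (dx z) (dx y) + mulPrim (dx y) (dx z) +
            (mulPrim (dx z) (dx y') + mulPrim (dx y') (dx z))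
        simp only [map_add, _root_.add_apply]
        abel)
      (fun c z y => ext_dx <| by
        change mulPrim (dx z) (dx (c • y)) + mulPrim (dx (c • y)) (dx z) =
          c • (mulPrim (dx z) (dx y) + mulPrim (dx y) (dx z))
        simp only [map_smul, _root_.smul_apply, smul_add]))
    2 fun z y => by
      change ‖mulPrim (dx z) (dx y) + mulPrim (dx y) (dx z)‖ ≤ 2 * ‖dx z‖ * ‖dx y‖
      refine (norm_add_le _ _).trans ((add_le_add (norm_mulPrim_le _ _)
        (norm_mulPrim_le _ _)).trans (le_of_eq ?_))
      ring

theorem norm_mul_le (z y : H01) : ‖mul z y‖ ≤ 2 * ‖z‖ * ‖y‖ :=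
  (mul.le_opNorm₂ z y).trans (by
    gcongr
    exact LinearMap.mkContinuous₂_norm_le _ zero_le_two _)

theorem fn_mul_ae_eq (z y : H01) : fn (mul z y) =ᵐ[unitVol] fun x => fn z x * fn y x := by
  filter_upwards [coeFn_mulPrim (dx z) (fn y), fn_ae_eq_prim z] with x h k
  rw [k]
  exact h

end H01


/-! ### Smooth functions vanishing at the endpoints belong to `H¹₀(0,1)` -/

theorem tendsto_contL2_of_bounded {f : ℕ → ℝ → ℂ} {g : ℝ → ℂ} (hf : ∀ k, Continuous (f k))
    (hg : Continuous g) {C : ℝ} (hC : ∀ k, ∀ x ∈ Ioo (0 : ℝ) 1, ‖f k x‖ ≤ C)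
    (hlim : ∀ x ∈ Ioo (0 : ℝ) 1, Tendsto (fun k => f k x) atTop (𝓝 (g x))) :
    Tendsto (fun k => contL2 (f k) (hf k)) atTop (𝓝 (contL2 g hg)) := by
  refine (Lp.tendsto_Lp_iff_tendsto_eLpNorm'' f
    (fun k => memLp_unitVol_of_continuous (hf k) 2) g (memLp_unitVol_of_continuous hg 2)).2 ?_
  refine tendsto_Lp_finite_of_tendsto_ae (by norm_num) (by norm_num)
    (fun k => (hf k).aestronglyMeasurable) (memLp_unitVol_of_continuous hg 2) ?_ ?_
  · refine unifIntegrable_of (by norm_num) (by norm_num)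
      (fun k => (hf k).aestronglyMeasurable) fun ε _ => ⟨(C + 1).toNNReal, fun k => ?_⟩
    rw [eLpNorm_congr_ae (g := 0), eLpNorm_zero]
    · exact zero_le
    filter_upwards [ae_restrict_mem measurableSet_Ioo] with x hx
    refine indicator_of_notMem (fun hmem => ?_) _
    have h1 : C + 1 ≤ ‖f k x‖ := Real.toNNReal_le_iff_le_coe.1 hmem
    linarith [hC k x hx]
  · filter_upwards [ae_restrict_mem measurableSet_Ioo] with x hx using hlim x hx

theorem deriv_smoothTransition_of_one_lt {y : ℝ} (hy : 1 < y) :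
    deriv Real.smoothTransition y = 0 := by
  have : Real.smoothTransition =ᶠ[𝓝 y] fun _ => 1 := by
    filter_upwards [lt_mem_nhds hy] with x hx using Real.smoothTransition.one_of_one_le hx.le
  rw [this.deriv_eq, deriv_const]

theorem exists_bound_deriv_smoothTransition :
    ∃ D : ℝ, ∀ y, |y + 1| * |deriv Real.smoothTransition y| ≤ D := by
  have hc : Continuous fun y => |y + 1| * |deriv Real.smoothTransition y| := by
    have := (Real.smoothTransition.contDiff (n := 1)).continuous_deriv le_rfl
    fun_prop
  obtain ⟨D, hD⟩ := (isCompact_Icc (a := (0 : ℝ)) (b := 1)).exists_bound_of_continuousOn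
    hc.continuousOn
  have hD0 : 0 ≤ D := (norm_nonneg _).trans (hD 0 (by simp))
  refine ⟨D, fun y => ?_⟩
  rcases lt_or_ge y 0 with h | h
  · have : Real.smoothTransition =ᶠ[𝓝 y] fun _ => 0 := by
      filter_upwards [gt_mem_nhds h] with x hx using Real.smoothTransition.zero_of_nonpos hx.le
    rw [this.deriv_eq, deriv_const]
    simpa using hD0
  rcases le_or_gt y 1 with h' | h'
  · exact (le_abs_self _).trans (hD y ⟨h, h'⟩)
  · rw [deriv_smoothTransition_of_one_lt h']
    simpa using hD0

/-- A smooth cutoff, equal to one on `[2/c, 1 - 2/c]` and to zero off `[1/c, 1 - 1/c]`. -/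
def cutoff (c x : ℝ) : ℝ :=
  Real.smoothTransition (c * x - 1) * Real.smoothTransition (c * (1 - x) - 1)

/-- The derivative of `cutoff c`. -/
def cutoffDeriv (c x : ℝ) : ℝ :=
  c * deriv Real.smoothTransition (c * x - 1) * Real.smoothTransition (c * (1 - x) - 1) -
    Real.smoothTransition (c * x - 1) * (c * deriv Real.smoothTransition (c * (1 - x) - 1))

theorem contDiff_cutoff (c : ℝ) : ContDiff ℝ (⊤ : ℕ∞) (cutoff c) :=
  (Real.smoothTransition.contDiff.comp (by fun_prop)).mul
    (Real.smoothTransition.contDiff.comp (by fun_prop))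

theorem continuous_cutoffDeriv (c : ℝ) : Continuous (cutoffDeriv c) := by
  have h1 := (Real.smoothTransition.contDiff (n := 1)).continuous_deriv le_rfl
  have h2 := Real.smoothTransition.continuous
  unfold cutoffDeriv
  fun_prop

theorem hasDerivAt_cutoff (c x : ℝ) : HasDerivAt (cutoff c) (cutoffDeriv c x) x := by
  have hS : ∀ y, HasDerivAt Real.smoothTransition (deriv Real.smoothTransition y) y := fun y =>
    ((Real.smoothTransition.contDiff (n := 1)).differentiable (by simp) y).hasDerivAt
  have h1 : HasDerivAt (fun x : ℝ => c * x - 1) c x := by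
    simpa using ((hasDerivAt_id x).const_mul c).sub_const 1
  have h2 : HasDerivAt (fun x : ℝ => c * (1 - x) - 1) (-c) x := by
    simpa using (((hasDerivAt_id x).const_sub 1).const_mul c).sub_const 1
  refine (((hS _).comp x h1).mul ((hS _).comp x h2)).congr_deriv ?_
  simp only [cutoffDeriv, Function.comp_apply]
  ring

theorem support_cutoff_subset {c : ℝ} :
    Function.support (cutoff c) ⊆ {x | 1 ≤ c * x ∧ 1 ≤ c * (1 - x)} := by
  intro x hx
  simp only [Function.mem_support, cutoff, mul_ne_zero_iff, ne_eq,
    Real.smoothTransition.zero_iff_nonpos, not_le] at hx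
  exact ⟨by linarith [hx.1], by linarith [hx.2]⟩

theorem abs_cutoff_le (c x : ℝ) : |cutoff c x| ≤ 1 := by
  rw [cutoff, abs_of_nonneg (mul_nonneg (Real.smoothTransition.nonneg _)
    (Real.smoothTransition.nonneg _))]
  exact mul_le_one₀ (Real.smoothTransition.le_one _) (Real.smoothTransition.nonneg _)
    (Real.smoothTransition.le_one _)

theorem isTestFunction_cutoff_mul {c : ℝ} (hc : 0 ≤ c) {f : ℝ → ℂ}
    (hf : ContDiff ℝ (⊤ : ℕ∞) f) : IsTestFunction fun x => (cutoff c x : ℂ) * f x := by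
  have hcl : IsClosed {x : ℝ | 1 ≤ c * x ∧ 1 ≤ c * (1 - x)} := by
    rw [ofPred_and]
    exact (isClosed_le (by fun_prop) (by fun_prop)).inter
      (isClosed_le (by fun_prop) (by fun_prop))
  have hsub : {x : ℝ | 1 ≤ c * x ∧ 1 ≤ c * (1 - x)} ⊆ Ioo 0 1 := by
    rintro x ⟨h1, h2⟩
    constructor
    · by_contra! h
      nlinarith
    · by_contra! h
      nlinarith
  have hts : tsupport (fun x => (cutoff c x : ℂ) * f x) ⊆
      {x : ℝ | 1 ≤ c * x ∧ 1 ≤ c * (1 - x)} := by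
    refine closure_minimal (fun x hx => support_cutoff_subset ?_) hcl
    intro h0
    exact hx (by simp [h0])
  refine ⟨(Complex.ofRealCLM.contDiff.comp (contDiff_cutoff c)).mul hf, ?_, hts.trans hsub⟩
  exact HasCompactSupport.of_support_subset_isCompact (isCompact_Icc (a := (0 : ℝ)) (b := 1))
    ((subset_tsupport _).trans (hts.trans (hsub.trans Ioo_subset_Icc_self)))

/-- The cutoffs `f · cutoff k` converge to `f` in the `H¹` norm: as `f` vanishes at the endpoints,
the large derivative of the cutoff meets only small values of `f`. -/
theorem contL2_pair_mem_closure {f f' : ℝ → ℂ} (hf : ContDiff ℝ (⊤ : ℕ∞) f)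
    (hf' : ∀ x, HasDerivAt f (f' x) x) (hfc : Continuous f) (hfc' : Continuous f')
    (h0 : f 0 = 0) (h1 : f 1 = 0) :
    (contL2 f hfc, contL2 f' hfc') ∈ testPairs.topologicalClosure := by
  obtain ⟨L, hL⟩ := (isCompact_Icc (a := (0 : ℝ)) (b := 1)).exists_bound_of_continuousOn
    hfc'.continuousOn
  have hL0 : 0 ≤ L := (norm_nonneg _).trans (hL 0 (by simp))
  obtain ⟨C, hC⟩ := (isCompact_Icc (a := (0 : ℝ)) (b := 1)).exists_bound_of_continuousOn
    hfc.continuousOn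
  obtain ⟨D, hD⟩ := exists_bound_deriv_smoothTransition
  have hlip : ∀ x ∈ Icc (0 : ℝ) 1, ∀ y ∈ Icc (0 : ℝ) 1, ‖f y - f x‖ ≤ L * ‖y - x‖ :=
    fun x hx y hy => (convex_Icc (0 : ℝ) 1).norm_image_sub_le_of_norm_hasDerivWithin_le
      (fun z _ => (hf' z).hasDerivWithinAt) hL hx hy
  let φ : ℕ → ℝ → ℂ := fun k x => (cutoff k x : ℂ) * f x
  let φ' : ℕ → ℝ → ℂ := fun k x => (cutoffDeriv k x : ℂ) * f x + (cutoff k x : ℂ) * f' x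
  have hφt : ∀ k, IsTestFunction (φ k) := fun k => isTestFunction_cutoff_mul k.cast_nonneg hf
  have hφd : ∀ k x, HasDerivAt (φ k) (φ' k x) x := fun k x =>
    (hasDerivAt_cutoff k x).ofReal_comp.mul (hf' x)
  have hφc : ∀ k, Continuous (φ k) := fun k => (hφt k).smooth.continuous
  have hφc' : ∀ k, Continuous (φ' k) := fun k => by
    have e1 := continuous_cutoffDeriv k
    have e2 := (contDiff_cutoff k).continuous
    exact ((Complex.continuous_ofReal.comp e1).mul hfc).add
      ((Complex.continuous_ofReal.comp e2).mul hfc')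
  have hev : ∀ x ∈ Ioo (0 : ℝ) 1, ∀ᶠ k : ℕ in atTop, cutoff k x = 1 ∧ cutoffDeriv k x = 0 := by
    intro x hx
    have t1 := (tendsto_natCast_atTop_atTop (R := ℝ)).atTop_mul_const hx.1
    have t2 := (tendsto_natCast_atTop_atTop (R := ℝ)).atTop_mul_const (sub_pos.2 hx.2)
    filter_upwards [t1.eventually_gt_atTop 2, t2.eventually_gt_atTop 2] with k a b
    rw [cutoff, cutoffDeriv, Real.smoothTransition.one_of_one_le (by linarith),
      Real.smoothTransition.one_of_one_le (by linarith),
      deriv_smoothTransition_of_one_lt (by linarith),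
      deriv_smoothTransition_of_one_lt (by linarith)]
    simp
  have hbd : ∀ (k : ℕ), ∀ x ∈ Ioo (0 : ℝ) 1, ‖φ' k x‖ ≤ 2 * (L * D) + L := by
    intro k x hx
    have hx' := Ioo_subset_Icc_self hx
    -- on the left `|f(x)| ≤ L x`, and `k x = (k x - 1) + 1` matches the weight in the bound `D`
    have b1 : ‖f x‖ ≤ L * x := by
      have := hlip 0 (by simp) x hx'
      rwa [h0, sub_zero, sub_zero, Real.norm_of_nonneg hx.1.le] at this
    have b2 : ‖f x‖ ≤ L * (1 - x) := by
      have := hlip x hx' 1 (by simp)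
      rwa [h1, zero_sub, norm_neg, Real.norm_of_nonneg (sub_nonneg.2 hx.2.le)] at this
    have key : ∀ y : ℝ, 0 ≤ y → ‖f x‖ ≤ L * y →
        (k : ℝ) * |deriv Real.smoothTransition (k * y - 1)| * ‖f x‖ ≤ L * D := by
      intro y hy hfy
      calc _ ≤ (k : ℝ) * |deriv Real.smoothTransition (k * y - 1)| * (L * y) := by gcongr
        _ = L * (|(k * y - 1) + 1| * |deriv Real.smoothTransition (k * y - 1)|) := by
            rw [sub_add_cancel, abs_of_nonneg (by positivity : 0 ≤ (k : ℝ) * y)]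
            ring
        _ ≤ L * D := by gcongr; exact hD _
    have hS : ∀ y, |Real.smoothTransition y| ≤ 1 := fun y => by
      rw [abs_of_nonneg (Real.smoothTransition.nonneg _)]
      exact Real.smoothTransition.le_one y
    have hcd : |cutoffDeriv k x| ≤ (k : ℝ) * |deriv Real.smoothTransition (k * x - 1)| +
        (k : ℝ) * |deriv Real.smoothTransition (k * (1 - x) - 1)| := by
      refine (abs_sub _ _).trans (add_le_add ?_ ?_)
      · rw [abs_mul, abs_mul, Nat.abs_cast]
        exact mul_le_of_le_one_right (by positivity) (hS _)
      · rw [abs_mul, abs_mul, Nat.abs_cast]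
        exact mul_le_of_le_one_left (by positivity) (hS _)
    calc ‖φ' k x‖ ≤ ‖(cutoffDeriv k x : ℂ) * f x‖ + ‖(cutoff k x : ℂ) * f' x‖ := norm_add_le _ _
      _ = |cutoffDeriv k x| * ‖f x‖ + |cutoff k x| * ‖f' x‖ := by
          simp only [norm_mul, Complex.norm_real, Real.norm_eq_abs]
      _ ≤ ((k : ℝ) * |deriv Real.smoothTransition (k * x - 1)| +
            (k : ℝ) * |deriv Real.smoothTransition (k * (1 - x) - 1)|) * ‖f x‖ + 1 * L := by
          gcongr
          · exact abs_cutoff_le _ _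
          · exact hL x hx'
      _ ≤ _ := by
          rw [add_mul]
          linarith [key x hx.1.le b1, key (1 - x) (sub_nonneg.2 hx.2.le) b2]
  refine mem_closure_of_tendsto (Tendsto.prodMk_nhds
    (tendsto_contL2_of_bounded hφc hfc (C := C) ?_ ?_)
    (tendsto_contL2_of_bounded hφc' hfc' hbd ?_)) (Eventually.of_forall fun k => ?_)
  · intro k x hx
    simp only [φ, norm_mul, Complex.norm_real, Real.norm_eq_abs]
    calc _ ≤ 1 * C := by
          gcongr
          · exact abs_cutoff_le _ _
          · exact hC x (Ioo_subset_Icc_self hx)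
      _ = C := one_mul C
  · intro x hx
    refine tendsto_const_nhds.congr' ?_
    filter_upwards [hev x hx] with k hk
    simp [φ, hk.1]
  · intro x hx
    refine tendsto_const_nhds.congr' ?_
    filter_upwards [hev x hx] with k hk
    simp [φ', hk.1, hk.2]
  · refine ⟨φ k, hφt k, coeFn_contL2 (φ k) (hφc k), ?_⟩
    have : deriv (φ k) = φ' k := funext fun x => (hφd k x).deriv
    rw [this]
    exact coeFn_contL2 (φ' k) (hφc' k)

/-! ### Completeness of the cosine system -/

theorem integral_cos_int_mul_pi (k : ℤ) :
    ∫ x in (0 : ℝ)..1, Real.cos (k * Real.pi * x) = if k = 0 then 1 else 0 := by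
  split_ifs with h
  · simp [h]
  · have : (k : ℝ) * Real.pi ≠ 0 := mul_ne_zero (by exact_mod_cast h) Real.pi_ne_zero
    rw [intervalIntegral.integral_comp_mul_left (fun x => Real.cos x) this]
    simp [Real.sin_int_mul_pi]

theorem L2I.integrable_mul (h : L2I) {g : ℝ → ℝ} (hg : Continuous g) :
    Integrable (fun x => h x * (g x : ℂ)) unitVol :=
  (Lp.memLp h).integrable_mul (memLp_unitVol_of_continuous (by fun_prop) 2)

/-- A function orthogonal to all `cos(nπx)` is orthogonal to all polynomials in `cos(πx)`, hence by
the Weierstrass theorem to all continuous functions. -/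
theorem L2I.eq_zero_of_integral_cos_eq_zero (h : L2I)
    (hcos : ∀ n : ℕ, ∫ x, h x * (Real.cos (n * Real.pi * x) : ℂ) ∂unitVol = 0) : h = 0 := by
  have hint : ∀ k : ℤ, ∫ x, h x * (Real.cos (k * Real.pi * x) : ℂ) ∂unitVol = 0 := by
    intro k
    obtain ⟨n, rfl | rfl⟩ := k.eq_nat_or_neg
    · exact_mod_cast hcos n
    · rw [← hcos n]
      refine integral_congr_ae (ae_of_all _ fun x => ?_)
      simp only [Int.cast_neg, Int.cast_natCast, neg_mul, Real.cos_neg]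
  have hpow : ∀ (m : ℕ) (k : ℤ), ∫ x, h x *
      ((Real.cos (Real.pi * x) ^ m * Real.cos (k * Real.pi * x) : ℝ) : ℂ) ∂unitVol = 0 := by
    intro m
    induction m with
    | zero => simpa using hint
    | succ m ih =>
      intro k
      have e : ∀ x : ℝ, h x * ((Real.cos (Real.pi * x) ^ (m + 1) *
          Real.cos (k * Real.pi * x) : ℝ) : ℂ) =
          (1 / 2) * (h x * ((Real.cos (Real.pi * x) ^ m *
            Real.cos ((k + 1 : ℤ) * Real.pi * x) : ℝ) : ℂ) +
          h x * ((Real.cos (Real.pi * x) ^ m *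
            Real.cos ((k - 1 : ℤ) * Real.pi * x) : ℝ) : ℂ)) := by
        intro x
        have e1 : Real.cos (Real.pi * x) * Real.cos (k * Real.pi * x) =
            (1 / 2) * (Real.cos ((k + 1 : ℤ) * Real.pi * x) +
              Real.cos ((k - 1 : ℤ) * Real.pi * x)) := by
          push_cast
          rw [show ((k : ℝ) + 1) * Real.pi * x = k * Real.pi * x + Real.pi * x by ring,
            show ((k : ℝ) - 1) * Real.pi * x = k * Real.pi * x - Real.pi * x by ring,
            Real.cos_add, Real.cos_sub]
          ring
        rw [pow_succ, mul_assoc (_ ^ m), e1]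
        push_cast
        ring
      simp only [e]
      rw [integral_const_mul, integral_add (L2I.integrable_mul h (by fun_prop))
        (L2I.integrable_mul h (by fun_prop)), ih, ih]
      simp
  have hpoly : ∀ p : Polynomial ℝ,
      ∫ x, h x * ((p.eval (Real.cos (Real.pi * x)) : ℝ) : ℂ) ∂unitVol = 0 := by
    intro p
    induction p using Polynomial.induction_on' with
    | add p q hp hq =>
      simp only [Polynomial.eval_add, Complex.ofReal_add, mul_add]
      rw [integral_add (L2I.integrable_mul h (by fun_prop))
        (L2I.integrable_mul h (by fun_prop)), hp, hq, add_zero]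
    | monomial m a =>
      have e := hpow m 0
      simp only [Int.cast_zero, zero_mul, Real.cos_zero, mul_one] at e
      simp only [Polynomial.eval_monomial, Complex.ofReal_mul, mul_left_comm _ (a : ℂ)]
      rw [integral_const_mul, e, mul_zero]
  have hcont : ∀ g : ℝ → ℝ, Continuous g → ∫ x, h x * (g x : ℂ) ∂unitVol = 0 := by
    intro g hg
    rw [← norm_le_zero_iff]
    refine le_of_forall_pos_le_add fun ε hε => ?_
    set I : ℝ := ∫ x, ‖h x‖ ∂unitVol with hI
    have hI0 : 0 ≤ I := integral_nonneg fun _ => norm_nonneg _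
    have hF : Continuous fun y => g (Real.arccos y / Real.pi) :=
      hg.comp (Real.continuous_arccos.div_const _)
    obtain ⟨p, hp⟩ := exists_polynomial_near_of_continuousOn (-1) 1 _ hF.continuousOn
      (ε / (I + 1)) (by positivity)
    have hpx : ∀ x ∈ Ioo (0 : ℝ) 1, |p.eval (Real.cos (Real.pi * x)) - g x| ≤ ε / (I + 1) := by
      intro x hx
      have := (hp (Real.cos (Real.pi * x)) ⟨Real.neg_one_le_cos _, Real.cos_le_one _⟩).le
      rwa [Real.arccos_cos (by have := Real.pi_pos; nlinarith [hx.1])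
        (by have := Real.pi_pos; nlinarith [hx.2]),
        mul_div_cancel_left₀ _ Real.pi_ne_zero] at this
    have hsub : ∫ x, h x * (g x : ℂ) ∂unitVol =
        ∫ x, h x * (((g x - p.eval (Real.cos (Real.pi * x))) : ℝ) : ℂ) ∂unitVol := by
      simp only [Complex.ofReal_sub, mul_sub]
      rw [integral_sub (L2I.integrable_mul h hg) (L2I.integrable_mul h (by fun_prop)), hpoly,
        sub_zero]
    rw [hsub, zero_add]
    calc _ ≤ ∫ x, (ε / (I + 1)) * ‖h x‖ ∂unitVol := by
          refine norm_integral_le_of_norm_le ((L2I.integrable h).norm.const_mul _) ?_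
          filter_upwards [ae_restrict_mem measurableSet_Ioo] with x hx
          rw [norm_mul, Complex.norm_real, Real.norm_eq_abs, abs_sub_comm, mul_comm]
          gcongr
          exact hpx x hx
      _ = ε * (I / (I + 1)) := by
          rw [integral_const_mul]
          ring
      _ ≤ ε := mul_le_of_le_one_right hε.le ((div_le_one (by positivity)).2 (by linarith))
  have hae : ∀ᵐ x, x ∈ Ioo (0 : ℝ) 1 → h x = 0 := by
    refine isOpen_Ioo.ae_eq_zero_of_integral_contDiff_smul_eq_zero
      (show IntegrableOn h (Ioo 0 1) volume from L2I.integrable h).locallyIntegrableOn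
      fun g hg _ hgs => ?_
    rw [← hcont g hg.continuous, ← setIntegral_eq_integral_of_forall_compl_eq_zero (s := Ioo 0 1)]
    · refine integral_congr_ae (ae_of_all _ fun x => ?_)
      simp [mul_comm]
    · intro x hx
      have : g x = 0 := by
        by_contra h0
        exact hx (hgs (subset_tsupport g h0))
      simp [this]
  refine Lp.ext ?_
  filter_upwards [Lp.coeFn_zero ℂ 2 unitVol, (ae_restrict_iff' measurableSet_Ioo).2 hae]
    with x h1 h2
  rw [h1, h2]
  rfl


/-! ### The sine basis of `H¹₀(0,1)` -/

/-- The frequency `(n + 1) π` of the `n`-th Dirichlet eigenfunction. -/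
def freq (n : ℕ) : ℝ := (n + 1) * Real.pi

theorem freq_pos (n : ℕ) : 0 < freq n := by unfold freq; positivity

/-- The function `√2 cos(a x)`. -/
def cosFn (a x : ℝ) : ℂ := ((√2 * Real.cos (a * x) : ℝ) : ℂ)

/-- The function `√2 sin(a x) / a`, a primitive of `√2 cos(a x)`. -/
def sinFn (a x : ℝ) : ℂ := ((√2 * Real.sin (a * x) / a : ℝ) : ℂ)

theorem continuous_cosFn (a : ℝ) : Continuous (cosFn a) := by unfold cosFn; fun_prop

theorem contDiff_sinFn (a : ℝ) : ContDiff ℝ (⊤ : ℕ∞) (sinFn a) := by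
  have h : ContDiff ℝ (⊤ : ℕ∞) fun x : ℝ => √2 * Real.sin (a * x) / a := by fun_prop
  exact Complex.ofRealCLM.contDiff.comp h

theorem hasDerivAt_sinFn {a : ℝ} (ha : a ≠ 0) (x : ℝ) : HasDerivAt (sinFn a) (cosFn a x) x := by
  have h : HasDerivAt (fun x : ℝ => √2 * Real.sin (a * x) / a) (√2 * Real.cos (a * x)) x := by
    refine (((((hasDerivAt_id x).const_mul a).sin).const_mul (√2)).div_const a).congr_deriv ?_
    simp only [id, mul_one]
    field_simp
  exact h.ofReal_comp

theorem hasDerivAt_cosFn {a : ℝ} (ha : a ≠ 0) (x : ℝ) :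
    HasDerivAt (cosFn a) (-(a : ℂ) ^ 2 * sinFn a x) x := by
  have h : HasDerivAt (fun x : ℝ => √2 * Real.cos (a * x))
      (-a ^ 2 * (√2 * Real.sin (a * x) / a)) x := by
    refine ((((hasDerivAt_id x).const_mul a).cos).const_mul (√2)).congr_deriv ?_
    simp only [id, mul_one]
    field_simp
  refine h.ofReal_comp.congr_deriv ?_
  simp [sinFn]

namespace H01

/-- The inner product `⟨z, y⟩ = ⟨z', y'⟩_{L²}`, which induces the norm of `H¹₀(0,1)`. -/
instance : InnerProductSpace ℂ H01 where
  inner z y := inner ℂ (dx z) (dx y)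
  norm_sq_eq_re_inner z := norm_sq_eq_re_inner (𝕜 := ℂ) (dx z)
  conj_inner_symm z y := inner_conj_symm (dx z) (dx y)
  add_left z y w := by rw [map_add, inner_add_left]
  smul_left z y c := by rw [map_smul, inner_smul_left]

theorem inner_eq (z y : H01) : inner ℂ z y = inner ℂ (dx z) (dx y) := rfl

/-- The normalized Dirichlet eigenfunction `√2 sin((n+1)πx) / ((n+1)π)`. -/
def sine (n : ℕ) : H01 :=
  ((⟨(contL2 (sinFn (freq n)) (contDiff_sinFn _).continuous,
      contL2 (cosFn (freq n)) (continuous_cosFn _)),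
    contL2_pair_mem_closure (contDiff_sinFn _) (hasDerivAt_sinFn (freq_pos n).ne')
      (contDiff_sinFn _).continuous (continuous_cosFn _) (by simp [sinFn]) (by
        have : Real.sin (freq n) = 0 := by
          have := Real.sin_nat_mul_pi (n + 1)
          push_cast at this
          exact this
        simp [sinFn, this])⟩ : ↥testPairs.topologicalClosure) : H01)

theorem fn_sine (n : ℕ) :
    fn (sine n) = contL2 (sinFn (freq n)) (contDiff_sinFn _).continuous := rfl

theorem dx_sine (n : ℕ) : dx (sine n) = contL2 (cosFn (freq n)) (continuous_cosFn _) := rfl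

theorem inner_sine (n : ℕ) (z : H01) : inner ℂ (sine n) z = pairL2 (dx z) (dx (sine n)) := by
  rw [inner_eq, L2.inner_def, pairL2_apply]
  refine integral_congr_ae ?_
  filter_upwards [coeFn_contL2 (cosFn (freq n)) (continuous_cosFn _)] with x hx
  rw [dx_sine, hx, RCLike.inner_apply, cosFn, Complex.conj_ofReal]

theorem orthonormal_sine : Orthonormal ℂ sine := by
  rw [orthonormal_iff_ite]
  intro n m
  have h1 : inner ℂ (sine n) (sine m) =
      ∫ x in (0 : ℝ)..1, ((Real.cos (((m : ℤ) - n : ℤ) * Real.pi * x) +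
        Real.cos (((m : ℤ) + n + 2 : ℤ) * Real.pi * x) : ℝ) : ℂ) := by
    rw [inner_sine, pairL2_apply, ← integral_unitVol]
    refine integral_congr_ae ?_
    filter_upwards [coeFn_contL2 (cosFn (freq n)) (continuous_cosFn _),
      coeFn_contL2 (cosFn (freq m)) (continuous_cosFn _)] with x hn hm
    rw [dx_sine, dx_sine, hn, hm, cosFn, cosFn, ← Complex.ofReal_mul]
    congr 1
    push_cast
    rw [show ((m : ℝ) - n) * Real.pi * x = freq m * x - freq n * x by unfold freq; ring,
      show ((m : ℝ) + n + 2) * Real.pi * x = freq m * x + freq n * x by unfold freq; ring,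
      Real.cos_add, Real.cos_sub]
    have := Real.mul_self_sqrt (zero_le_two (α := ℝ))
    linear_combination (Real.cos (freq m * x) * Real.cos (freq n * x)) * this
  rw [h1, intervalIntegral.integral_ofReal, intervalIntegral.integral_add
    (Continuous.intervalIntegrable (by fun_prop) _ _)
    (Continuous.intervalIntegrable (by fun_prop) _ _), integral_cos_int_mul_pi,
    integral_cos_int_mul_pi, if_neg (by omega : ¬ ((m : ℤ) + n + 2 = 0)), add_zero]
  by_cases h : n = m
  · simp [h]
  · rw [if_neg (by omega), if_neg h, Complex.ofReal_zero]

theorem orthogonal_span_sine : (Submodule.span ℂ (range sine))ᗮ = ⊥ := by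
  rw [eq_bot_iff]
  intro z hz
  rw [Submodule.mem_orthogonal] at hz
  refine ext_dx ?_
  rw [map_zero]
  refine L2I.eq_zero_of_integral_cos_eq_zero _ fun n => ?_
  cases n with
  | zero =>
    have h := pairL2_dx_eq_neg z (g := fun _ => 1) (g' := fun _ => 0)
      (fun x => hasDerivAt_const x 1) continuous_const continuous_const
    rw [pairL2_apply, pairL2_apply] at h
    have e1 : ∫ x, dx z x * (Real.cos ((0 : ℕ) * Real.pi * x) : ℂ) ∂unitVol =
        ∫ x, dx z x * contL2 (fun _ => (1 : ℂ)) continuous_const x ∂unitVol := by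
      refine integral_congr_ae ?_
      filter_upwards [coeFn_contL2 (fun _ => (1 : ℂ)) continuous_const] with x hx
      rw [hx]
      simp
    have e2 : ∫ x, fn z x * contL2 (fun _ => (0 : ℂ)) continuous_const x ∂unitVol = 0 := by
      rw [integral_congr_ae (g := fun _ => 0), integral_zero]
      filter_upwards [coeFn_contL2 (fun _ => (0 : ℂ)) continuous_const] with x hx
      rw [hx, mul_zero]
    rw [e1, h, e2, neg_zero]
  | succ n =>
    have h := hz (sine n) (Submodule.subset_span (mem_range_self n))
    rw [inner_sine, pairL2_apply] at h
    have e : ∫ x, dx z x * dx (sine n) x ∂unitVol =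
        (√2 : ℂ) * ∫ x, dx z x * (Real.cos ((n + 1 : ℕ) * Real.pi * x) : ℂ) ∂unitVol := by
      rw [← integral_const_mul]
      refine integral_congr_ae ?_
      filter_upwards [coeFn_contL2 (cosFn (freq n)) (continuous_cosFn _)] with x hx
      rw [dx_sine, hx, cosFn, freq]
      push_cast
      ring
    rw [e] at h
    refine (mul_eq_zero.1 h).resolve_left ?_
    exact_mod_cast (Real.sqrt_pos.2 zero_lt_two).ne'

/-- The sine functions form a Hilbert basis of `H¹₀(0,1)`. -/
def sineBasis : HilbertBasis ℕ ℂ H01 :=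
  HilbertBasis.mkOfOrthogonalEqBot orthonormal_sine orthogonal_span_sine

theorem coe_sineBasis : ⇑sineBasis = sine :=
  HilbertBasis.coe_mkOfOrthogonalEqBot orthonormal_sine orthogonal_span_sine

theorem repr_sineBasis (z : H01) (n : ℕ) :
    sineBasis.repr z n = pairL2 (dx z) (dx (sine n)) := by
  rw [HilbertBasis.repr_apply_apply, coe_sineBasis, inner_sine]

/-! ### The second derivative in the sine basis -/

/-- The inclusion into `L²(0,1)` as a bounded operator. -/
def fnL : H01 →L[ℂ] L2I :=
  fn.mkContinuous 1 fun z => by rw [one_mul]; exact poincare z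

/-- The weak derivative as a bounded operator. -/
def dxL : H01 →L[ℂ] L2I :=
  dx.mkContinuous 1 fun z => by rw [one_mul, norm_eq]

/-- The test functions in the definition of the weak derivative may be taken in `H¹₀(0,1)`. -/
theorem isWeakDeriv_iff_forall_h01 (f g : L2I) :
    IsWeakDeriv f g ↔ ∀ w : H01, pairL2 f (dx w) = -pairL2 g (fn w) := by
  constructor
  · intro h w
    have hcl : IsClosed {p : L2I × L2I | pairL2 f p.2 = -pairL2 g p.1} :=
      isClosed_eq (by fun_prop) (by fun_prop)
    refine closure_minimal (fun p hp => ?_) hcl w.2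
    obtain ⟨φ, hφ, h1, h2⟩ := hp
    change pairL2 f p.2 = -pairL2 g p.1
    have e1 : ∫ x, f x * p.2 x ∂unitVol = ∫ x, f x * deriv φ x ∂unitVol :=
      integral_congr_ae (h2.mono fun x hx => by beta_reduce; rw [hx])
    have e2 : ∫ x, g x * p.1 x ∂unitVol = ∫ x, g x * φ x ∂unitVol :=
      integral_congr_ae (h1.mono fun x hx => by beta_reduce; rw [hx])
    rw [pairL2_apply, pairL2_apply, e1, e2]
    exact h φ hφ
  · intro h φ hφ
    have e1 := coeFn_contL2 φ hφ.smooth.continuous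
    have e2 := coeFn_contL2 (deriv φ) hφ.continuous_deriv
    have := h ((⟨(contL2 φ hφ.smooth.continuous, contL2 (deriv φ) hφ.continuous_deriv),
      testPairs.le_topologicalClosure ⟨φ, hφ, e1, e2⟩⟩ : ↥testPairs.topologicalClosure) : H01)
    change pairL2 f (contL2 (deriv φ) hφ.continuous_deriv) =
      -pairL2 g (contL2 φ hφ.smooth.continuous) at this
    rw [pairL2_apply, pairL2_apply] at this
    have e3 := integral_congr_ae (e2.mono fun x hx => congrArg (f x * ·) hx)
    have e4 := integral_congr_ae (e1.mono fun x hx => congrArg (g x * ·) hx)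
    exact e3.symm.trans (this.trans (congrArg Neg.neg e4))

theorem repr_sineBasis_eq_sq_mul (z : H01) (n : ℕ) :
    sineBasis.repr z n = (freq n : ℂ) ^ 2 * pairL2 (fn z) (fn (sine n)) := by
  rw [repr_sineBasis, dx_sine, pairL2_dx_eq_neg z (hasDerivAt_cosFn (freq_pos n).ne')
    (continuous_cosFn _) (continuous_const.mul (contDiff_sinFn _).continuous)]
  have : contL2 (fun x => -(freq n : ℂ) ^ 2 * sinFn (freq n) x)
      (continuous_const.mul (contDiff_sinFn _).continuous) =
      (-(freq n : ℂ) ^ 2) • fn (sine n) := by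
    rw [fn_sine, contL2, contL2, ← MemLp.toLp_const_smul]
    rfl
  rw [this, map_smul, smul_eq_mul]
  ring

/-- `φ'' = ψ` weakly if and only if the sine coefficients are multiplied by `-((n+1)π)²`. -/
theorem isWeakDeriv_dx_fn_iff (φ ψ : H01) :
    IsWeakDeriv (dx φ) (fn ψ) ↔
      ∀ n, sineBasis.repr ψ n = -(freq n : ℂ) ^ 2 * sineBasis.repr φ n := by
  have hne : ∀ n, (freq n : ℂ) ^ 2 ≠ 0 := fun n =>
    pow_ne_zero 2 (Complex.ofReal_ne_zero.2 (freq_pos n).ne')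
  have hn : ∀ n, pairL2 (dx φ) (dx (sine n)) = -pairL2 (fn ψ) (fn (sine n)) ↔
      sineBasis.repr ψ n = -(freq n : ℂ) ^ 2 * sineBasis.repr φ n := by
    intro n
    rw [repr_sineBasis_eq_sq_mul ψ, repr_sineBasis φ, neg_mul, ← mul_neg, mul_right_inj' (hne n)]
    exact ⟨fun h => by rw [h, neg_neg], fun h => by rw [h, neg_neg]⟩
  rw [isWeakDeriv_iff_forall_h01]
  refine ⟨fun h n => (hn n).1 (h _), fun h w => ?_⟩
  have heq : (pairL2 (dx φ)).comp dxL = -(pairL2 (fn ψ)).comp fnL := by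
    refine ContinuousLinearMap.ext_on (s := range sine) ?_ ?_
    · have := sineBasis.dense_span
      rw [coe_sineBasis] at this
      exact Submodule.dense_iff_topologicalClosure_eq_top.2 this
    · rintro _ ⟨n, rfl⟩
      exact (hn n).2 (h n)
  exact DFunLike.congr_fun heq w

end H01

/-! ### The Schrödinger operator -/

/-- The eigenvalues `-i ((n+1)π)² - 1` of `A φ = i φ'' - φ`. -/
def schrodingerEigenvalue (n : ℕ) : ℂ := -Complex.I * (freq n : ℂ) ^ 2 - 1

theorem re_schrodingerEigenvalue (n : ℕ) : (schrodingerEigenvalue n).re = -1 := by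
  rw [schrodingerEigenvalue, ← Complex.ofReal_pow, neg_mul, Complex.sub_re, Complex.neg_re,
    Complex.I_mul_re, Complex.ofReal_im, neg_zero, neg_zero, Complex.one_re, zero_sub]

/-- The operator `A φ = i φ'' - φ` is diagonal in the sine basis. -/
theorem isSchrodingerOperator_diagonalPMap :
    IsSchrodingerOperator (H01.sineBasis.diagonalPMap schrodingerEigenvalue) := by
  intro φ η
  rw [HilbertBasis.mem_graph_diagonalPMap]
  have hI := Complex.I_mul_I
  constructor
  · intro h
    refine ⟨-Complex.I • (η + φ), ?_, ?_⟩
    · rw [H01.isWeakDeriv_dx_fn_iff]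
      intro n
      rw [map_smul, map_add, lp.coeFn_smul, Pi.smul_apply, lp.coeFn_add, Pi.add_apply, h n,
        schrodingerEigenvalue, smul_eq_mul]
      linear_combination ((freq n : ℂ) ^ 2 * H01.sineBasis.repr φ n) * hI
    · rw [smul_smul, mul_neg, hI, neg_neg, one_smul, add_sub_cancel_right]
  · rintro ⟨ψ, hψ, rfl⟩ n
    rw [H01.isWeakDeriv_dx_fn_iff] at hψ
    rw [map_sub, map_smul, lp.coeFn_sub, Pi.sub_apply, lp.coeFn_smul, Pi.smul_apply, hψ n,
      schrodingerEigenvalue, smul_eq_mul]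
    ring


/-! ### The Schrödinger group and its feedback system -/

theorem exists_schrodingerGroup :
    ∃ T : DampedGroup H01, ∀ t x n, H01.sineBasis.repr (T.op t x) n =
      Complex.exp (schrodingerEigenvalue n * t) * H01.sineBasis.repr x n :=
  H01.sineBasis.exists_dampedGroup _ re_schrodingerEigenvalue

/-- The damped Schrödinger group on `H¹₀(0,1)`, generated by `A φ = i φ'' - φ`. -/
def schrodingerGroup : DampedGroup H01 := exists_schrodingerGroup.choose

/-- The damped Schrödinger equation with quadratic nonlinearity as a bilinear feedback system. -/
def schrodingerSystem : BilinearFeedbackSystem H01 H01 H01 H01 where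
  A := H01.sineBasis.diagonalPMap schrodingerEigenvalue
  T := schrodingerGroup.toC0Semigroup
  isGenerator := H01.sineBasis.isGenerator_diagonalPMap _ _ exists_schrodingerGroup.choose_spec
  B₁ := ContinuousLinearMap.id ℂ H01
  B₂ := ContinuousLinearMap.id ℂ H01
  C := ContinuousLinearMap.id ℂ H01
  emb := ContinuousLinearMap.id ℂ H01
  emb_injective := Function.injective_id
  N := H01.mul
  N_bound := by
    refine ⟨2, zero_lt_two, 1 / 2, ⟨by norm_num, by norm_num⟩, fun z y => ?_⟩
    rw [ContinuousLinearMap.id_apply, mul_assoc, ← Real.rpow_add_of_nonneg (norm_nonneg y)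
      (by norm_num) (by norm_num), sub_add_cancel, Real.rpow_one]
    exact H01.norm_mul_le z y

theorem isSchrodingerSystem_schrodingerSystem : IsSchrodingerSystem schrodingerSystem where
  A_eq := isSchrodingerOperator_diagonalPMap
  B₁_eq := rfl
  B₂_eq := rfl
  C_eq := rfl
  emb_eq := rfl
  N_eq := H01.fn_mul_ae_eq

/-! ### Well-posedness and stability of the feedback system -/

theorem admissibleControl_schrodingerSystem :
    schrodingerSystem.AdmissibleControl (ContinuousLinearMap.id ℂ H01) := by
  refine fun t ht => ⟨1, fun u hu => ?_⟩
  have hw : expWeight 0 u = u := by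
    funext s
    simp [expWeight]
  have hu' : MemLp (expWeight 0 u) 2 (volume.restrict (Ioi 0)) := by rwa [hw]
  have h := schrodingerGroup.exp_mul_norm_duhamel_le_l2wNorm (by norm_num) ht.le hu'
  rw [zero_mul, Real.exp_zero, one_mul] at h
  have h2 := h.trans (NNReal.coe_le_coe.2 (l2wNorm_mono hu' Ioo_subset_Ioi_self))
  rw [coe_l2wNorm, hw] at h2
  rw [one_mul]
  exact h2

theorem admissibleObservation_schrodingerSystem : schrodingerSystem.AdmissibleObservation := by
  refine fun t ht => ⟨√t, fun x => ?_⟩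
  have hc : Continuous (schrodingerSystem.outputMap x) := schrodingerGroup.continuous_orbit x
  have hb : ∀ᵐ s ∂volume.restrict (Ioo 0 t), ‖schrodingerSystem.outputMap x s‖ ≤ ‖x‖ := by
    filter_upwards [ae_restrict_mem measurableSet_Ioo] with s hs
    refine (schrodingerGroup.norm_op_apply_le s x).trans
      (mul_le_of_le_one_left (norm_nonneg x) ?_)
    exact Real.exp_le_one_iff.2 (by linarith [hs.1])
  refine ⟨MemLp.of_bound hc.aestronglyMeasurable _ hb, ?_⟩
  have h := ENNReal.toReal_mono (by finiteness) (eLpNorm_le_of_ae_bound (p := 2) hb)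
  refine h.trans (le_of_eq ?_)
  rw [ENNReal.toReal_mul, ENNReal.toReal_ofReal (norm_nonneg x), ← ENNReal.toReal_rpow,
    Measure.restrict_apply_univ, Real.volume_Ioo, sub_zero, ENNReal.toReal_ofReal ht.le,
    Real.sqrt_eq_rpow]
  norm_num

theorem boundedTransfer_schrodingerSystem :
    schrodingerSystem.BoundedTransfer (ContinuousLinearMap.id ℂ H01) := by
  refine ⟨0, 1, fun α hα => ?_⟩
  obtain ⟨R, hR, hR1⟩ := H01.sineBasis.exists_isResolventAt_diagonalPMap _
    re_schrodingerEigenvalue hα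
  exact ⟨R, hR, hR1⟩

theorem linearWellPosed_schrodingerSystem : schrodingerSystem.LinearWellPosed where
  control₁ := admissibleControl_schrodingerSystem
  control₂ := admissibleControl_schrodingerSystem
  observation := admissibleObservation_schrodingerSystem
  transfer₁ := boundedTransfer_schrodingerSystem
  transfer₂ := boundedTransfer_schrodingerSystem

theorem isSolution_of_isMild {z₀ : H01} {u z : ℝ → H01} (hzc : Continuous z)
    (hz : schrodingerGroup.IsMild H01.mul z₀ u z) : schrodingerSystem.IsSolution z₀ u z z where
  continuousOn := hzc.continuousOn
  memLp_output t _ := by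
    obtain ⟨C, hC⟩ := (isCompact_Icc (a := (0 : ℝ)) (b := t)).exists_bound_of_continuousOn
      hzc.continuousOn
    refine MemLp.of_bound hzc.aestronglyMeasurable C ?_
    filter_upwards [ae_restrict_mem measurableSet_Ioo] with s hs
      using hC s (Ioo_subset_Icc_self hs)
  state_eq := hz
  output_eq := by
    filter_upwards [ae_restrict_mem measurableSet_Ioi] with t ht using hz t (le_of_lt ht)

/-- As `C` is the identity, the output of a solution is the state almost everywhere. -/
theorem output_ae_eq_of_isSolution {z₀ : H01} {u z y : ℝ → H01}
    (h : schrodingerSystem.IsSolution z₀ u z y) : y =ᵐ[volume.restrict (Ioi (0 : ℝ))] z := by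
  filter_upwards [h.output_eq, ae_restrict_mem measurableSet_Ioi] with t ht ht0
  rw [ht, h.state_eq t (le_of_lt ht0)]
  rfl

theorem isMild_of_isSolution {z₀ : H01} {u z y : ℝ → H01}
    (h : schrodingerSystem.IsSolution z₀ u z y) : schrodingerGroup.IsMild H01.mul z₀ u z := by
  intro t ht
  have hy : (fun s => H01.mul (z s) (y s)) =ᵐ[volume.restrict (Ioi (0 : ℝ))]
      fun s => H01.mul (z s) (z s) :=
    (output_ae_eq_of_isSolution h).mono fun s hs => congrArg (H01.mul (z s)) hs
  rw [← schrodingerGroup.duhamel_congr_ae ht hy]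
  exact h.state_eq t ht

/-- Global solvability, uniqueness and exponential decay for small data. -/
theorem exists_unique_solution_of_small {z₀ : H01} {u₁ : ℝ → H01} (hu : MemL2w (1 / 2) u₁)
    (hsmall : ‖z₀‖ + l2wNorm (1 / 2) (Ioi 0) u₁ ≤ 1 / 32) :
    ∃ (z : ℝ → H01) (y : ℝ → H01), schrodingerSystem.IsSolution z₀ u₁ z y ∧
      (∀ (z' : ℝ → H01) (y' : ℝ → H01), schrodingerSystem.IsSolution z₀ u₁ z' y' →
        EqOn z' z (Ici 0) ∧ y' =ᵐ[volume.restrict (Ioi (0 : ℝ))] y) ∧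
      ∀ t : ℝ, 0 ≤ t →
        ‖z t‖ ≤ ‖z₀‖ * Real.exp (-(1 / 2) * t)
          + 2 * Real.exp (-(1 / 2) * t) * l2wNorm (1 / 2) (Ioo 0 t) u₁ := by
  -- the product has norm `K = 2`, so the radius is `r = 1 / 16` and the data are below `r / 2`
  have hr : (1 / 16 : ℝ) = 1 / (8 * 2) := by norm_num
  obtain ⟨z, hzc, hz, hzr⟩ := schrodingerGroup.exists_isMild zero_lt_two hr H01.norm_mul_le hu
    (hsmall.trans (by norm_num))
  refine ⟨z, z, isSolution_of_isMild hzc hz, fun z' y' h' => ?_, fun t ht => ?_⟩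
  · have heq : EqOn z' z (Ici 0) := hz.eqOn schrodingerGroup zero_le_two H01.norm_mul_le
      hzc.continuousOn (isMild_of_isSolution h') h'.continuousOn
    refine ⟨heq, ?_⟩
    filter_upwards [output_ae_eq_of_isSolution h', ae_restrict_mem measurableSet_Ioi]
      with t h1 h2
    rw [h1, heq (Ioi_subset_Ici_self h2)]
  · have h := hz.norm_le schrodingerGroup zero_lt_two hr H01.norm_mul_le hu hzc hzr ht
    calc ‖z t‖ = Real.exp (-(1 / 2) * t) * (Real.exp (t / 2) * ‖z t‖) := by
          rw [← mul_assoc, ← Real.exp_add]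
          ring_nf
          simp
      _ ≤ Real.exp (-(1 / 2) * t) * (‖z₀‖ + 2 * l2wNorm (1 / 2) (Ioo 0 t) u₁) := by gcongr
      _ = _ := by ring

theorem isClassKL_mul_exp {ω : ℝ} (hω : 0 < ω) :
    IsClassKL fun s t : ℝ≥0 => s * (Real.exp (-ω * t)).toNNReal where
  continuous := by
    have h : Continuous fun p : ℝ≥0 × ℝ≥0 => (Real.exp (-ω * p.2)).toNNReal :=
      continuous_real_toNNReal.comp (by fun_prop)
    exact continuous_fst.mul h
  strictMono t := by
    have h : 0 < (Real.exp (-ω * t)).toNNReal := Real.toNNReal_pos.2 (Real.exp_pos _)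
    exact fun s s' hs => mul_lt_mul_of_pos_right hs h
  zero t := zero_mul _
  strictAnti s hs t t' ht := by
    refine mul_lt_mul_of_pos_left ?_ hs
    rw [Real.toNNReal_lt_toNNReal_iff (Real.exp_pos _), Real.exp_lt_exp]
    have : (t : ℝ) < t' := ht
    nlinarith
  tendsto s _ := by
    have h1 : Tendsto (fun t : ℝ≥0 => -ω * (t : ℝ)) atTop atBot :=
      (NNReal.tendsto_coe_atTop.2 tendsto_id).const_mul_atTop_of_neg (neg_neg_of_pos hω)
    have h2 := tendsto_real_toNNReal (Real.tendsto_exp_atBot.comp h1)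
    rw [Real.toNNReal_zero] at h2
    simpa using h2.const_mul s

theorem isClassKInfty_two_mul : IsClassKInfty fun s : ℝ≥0 => 2 * s where
  continuous := by fun_prop
  strictMono := fun s s' hs => mul_lt_mul_of_pos_left hs two_pos
  zero := mul_zero 2
  tendsto := tendsto_id.const_mul_atTop' two_pos

theorem locallyL2wISS_schrodingerSystem : schrodingerSystem.LocallyL2wISS (1 / 2) := by
  refine ⟨_, _, isClassKL_mul_exp (ω := 1 / 2) (by norm_num), isClassKInfty_two_mul, 1 / 32,
    by norm_num, fun z₀ u₁ hu hsmall => ?_⟩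
  obtain ⟨z, y, hsol, -, hest⟩ := exists_unique_solution_of_small hu hsmall
  refine ⟨z, y, hsol, fun t => ?_⟩
  rw [← NNReal.coe_le_coe]
  push_cast
  rw [Real.coe_toNNReal _ (Real.exp_pos _).le]
  refine (hest t t.2).trans ?_
  have : Real.exp (-(1 / 2) * (t : ℝ)) ≤ 1 := Real.exp_le_one_iff.2 (by linarith [t.2])
  gcongr
  linarith

theorem mainTheorem8 :
    ∃ S : BilinearFeedbackSystem H01 H01 H01 H01,
      IsSchrodingerSystem S ∧ S.LinearWellPosed ∧
      ∃ ω ε c : ℝ, 0 < ω ∧ 0 < ε ∧ 0 < c ∧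
        (∀ (z₀ : H01) (u₁ : ℝ → H01), MemL2w ω u₁ →
          ‖z₀‖ + l2wNorm ω (Ioi 0) u₁ ≤ ε →
          ∃ (z : ℝ → H01) (y : ℝ → H01), S.IsSolution z₀ u₁ z y ∧
            (∀ (z' : ℝ → H01) (y' : ℝ → H01), S.IsSolution z₀ u₁ z' y' →
              EqOn z' z (Ici 0) ∧ y' =ᵐ[volume.restrict (Ioi (0 : ℝ))] y) ∧
            ∀ t : ℝ, 0 ≤ t →
              ‖z t‖ ≤ ‖z₀‖ * Real.exp (-ω * t)
                + c * Real.exp (-ω * t) * l2wNorm ω (Ioo 0 t) u₁) ∧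
        S.LocallyL2wISS ω :=
  ⟨schrodingerSystem, isSchrodingerSystem_schrodingerSystem, linearWellPosed_schrodingerSystem,
    1 / 2, 1 / 32, 2, by norm_num, by norm_num, by norm_num,
    fun _ _ hu hsmall => exists_unique_solution_of_small hu hsmall,
    locallyL2wISS_schrodingerSystem⟩

end
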